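/- Let $m\ge 5$, and let $C_{5,m}$ be the tree on $m+5$ vertices obtained from the path $P_{m+1}$ on the $m+1$ vertices $v_5,v_7,v_9,\ldots,v_{10},v_8,v_6$ (in this order along the path; for $m=5$ these are exactly the six vertices written) by attaching two leaves $v_1,v_2$ to its end $v_5$ and two leaves $v_3,v_4$ to its other end $v_6$. Let $X=(x_v)_v$ be indeterminates indexed by the vertices, with $x_i=x_{v_i}$, and let $L(C_{5,m},X)=\mathrm{Diag}(X)-A$ be the generalized Laplacian, where $A$ is the adjacency matrix. For $j\ge 1$ let $I_j=I_j(C_{5,m},X)\subseteq\mathbb{Z}[X]$ be the $j$-th critical ideal, i.e. the ideal generated by the $j$-minors of $L(C_{5,m},X)$, and let $\gamma(C_{5,m})$ be the largest $j$ with $I_j=\mathbb{Z}[X]$. For vertices $v_i,v_j$ let $\mathcal{P}_{i,j}$ be the determinant of the generalized Laplacian of the unique path in $C_{5,m}$ joining $v_i$ and $v_j$. Then: 1. $C_{5,m}$ is a tree, and with $\mathbf{d}=(2,\ldots,2)$ and $\mathbf{r}=(1,1,1,1,2,\ldots,2)^t$ (value $1$ at the four leaves and $2$ at the other vertices) the triple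 $(C_{5,m},\mathbf{d},\mathbf{r})$ is an arithmetical graph, i.e. $\mathbf{d},\mathbf{r}$ have positive integer entries and $(\mathrm{Diag}(\mathbf{d})-A)\mathbf{r}=0$. 2. $\gamma(C_{5,m})=m+2$. Exactly three of the critical ideals $I_1,\ldots,I_{m+5}$ are non-trivial (different from $\mathbb{Z}[X]$), namely $I_{m+3}$, $I_{m+4}$ and $I_{m+5}$, and these are $$I_{m+3}=\langle x_1,\,x_2,\,x_3,\,x_4,\,\mathcal{P}_{7,8}\rangle,$$ $$I_{m+4}=\langle x_1x_3,\;x_1x_4,\;x_2x_3,\;x_2x_4,\;\mathcal{P}_{1,2}\mathcal{P}_{7,8}-x_1x_2\mathcal{P}_{9,8},\;\mathcal{P}_{3,4}\mathcal{P}_{7,8}-x_3x_4\mathcal{P}_{7,10}\rangle,$$ $$I_{m+5}=\langle\det L(C_{5,m},X)\rangle.$$ 3. The critical group (group of components) $K(C_{5,m},\mathbf{d},\mathbf{r})$, i.e. the torsion subgroup of $\mathbb{Z}^{m+5}/\mathrm{Im}(\mathrm{Diag}(\mathbf{d})-A)$, is isomorphic to $\mathbb{Z}_2^2$ if $m$ is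 even and to $\mathbb{Z}_4$ if $m$ is odd. -/

import Mathlib

/-- The generalized Laplacian matrix `L(G, x) = Diag(x) - A(G)`, where `A(G)` is the adjacency
matrix of `G`. -/
def genLaplacian {V R : Type*} [DecidableEq V] [CommRing R] (G : SimpleGraph V)
    [DecidableRel G.Adj] (x : V → R) : Matrix V V R :=
  Matrix.diagonal x - G.adjMatrix R

/-- The generalized Laplacian `L(G, X_G)` at the indeterminates `x_v`, one for each vertex. -/
noncomputable def genLaplacianX {V : Type*} [DecidableEq V] (G : SimpleGraph V)
    [DecidableRel G.Adj] : Matrix V V (MvPolynomial V ℤ) :=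
  genLaplacian G MvPolynomial.X

/-- The `j`-th critical ideal `I_j(G, X)`: the ideal of `ℤ[x_v : v ∈ V]` generated by the
`j`-minors of `L(G, X_G)`. Rows and columns are listed injectively, in any order; reordering them
changes a minor at most by a sign. -/
noncomputable def criticalIdeal {V : Type*} [DecidableEq V] (G : SimpleGraph V)
    [DecidableRel G.Adj] (j : ℕ) : Ideal (MvPolynomial V ℤ) :=
  Ideal.span {p | ∃ f g : Fin j ↪ V, p = ((genLaplacianX G).submatrix f g).det}

/-- `γ(G) = k`: `k` is the largest `j` for which `I_j(G, X)` is the whole polynomial ring. -/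
def IsAlgebraicCorank {V : Type*} [DecidableEq V] (G : SimpleGraph V)
    [DecidableRel G.Adj] (k : ℕ) : Prop :=
  IsGreatest {j : ℕ | criticalIdeal G j = ⊤} k

/-- The vertices lying on a path from `u` to `v`. In a tree this is the vertex set of the unique
path joining `u` and `v`. -/
def pathVertices {V : Type*} (G : SimpleGraph V) (u v : V) : Set V :=
  {w | ∃ p : G.Walk u v, p.IsPath ∧ w ∈ p.support}

open Classical in
/-- In a tree `G`: the determinant of the generalized Laplacian of the path `P(u, v)`, as a
polynomial in the variables of `G`. A path of a tree is an induced subgraph, so its generalized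
Laplacian is the principal submatrix of `L(G, X_G)` on its vertices. -/
noncomputable def pathDet {V : Type*} [Fintype V] [DecidableEq V] (G : SimpleGraph V)
    [DecidableRel G.Adj] (u v : V) : MvPolynomial V ℤ :=
  ((genLaplacianX G).submatrix (fun w : pathVertices G u v => (w : V))
    (fun w : pathVertices G u v => (w : V))).det

/-- `(G, d, r)` is an arithmetical graph: `d` and `r` are vectors of positive integers with
`(Diag(d) - A) r = 0`. -/
structure IsArithmeticalGraph {V : Type*} [Fintype V] [DecidableEq V] (G : SimpleGraph V)
    [DecidableRel G.Adj] (d r : V → ℤ) : Prop where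
  d_pos : ∀ v, 0 < d v
  r_pos : ∀ v, 0 < r v
  mulVec_eq_zero : (genLaplacian G d).mulVec r = 0

/-- The critical group (group of components) of an arithmetical graph `(G, d, r)`: the torsion
part of `ℤ^V / Im(M)`, where `M = Diag(d) - A`. It depends on `G` and `d` only. -/
abbrev criticalGroup {V : Type*} [Fintype V] [DecidableEq V] (G : SimpleGraph V)
    [DecidableRel G.Adj] (d : V → ℤ) : Type _ :=
  Submodule.torsion ℤ ((V → ℤ) ⧸ LinearMap.range (genLaplacian G d).mulVecLin)

/-- Vertices of `C_{5,m}`: four leaves, and the `m + 1` vertices of the path `P_{m+1}`, which are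
numbered consecutively from `0` to `m`. -/
abbrev C5Vertex (m : ℕ) : Type := Fin 4 ⊕ Fin (m + 1)

/-- One orientation of the edges of `C_{5,m}`: the leaves `0, 1` hang on the first vertex of the
path, the leaves `2, 3` hang on its last vertex, and consecutive vertices of the path are joined. -/
def C5Rel (m : ℕ) : C5Vertex m → C5Vertex m → Prop
  | Sum.inl i, Sum.inr k => (i.val < 2 ∧ k.val = 0) ∨ (2 ≤ i.val ∧ k.val = m)
  | Sum.inr k, Sum.inr l => k.val + 1 = l.val
  | _, _ => False

instance (m : ℕ) : DecidableRel (C5Rel m)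
  | Sum.inl i, Sum.inr k =>
    inferInstanceAs (Decidable ((i.val < 2 ∧ k.val = 0) ∨ (2 ≤ i.val ∧ k.val = m)))
  | Sum.inr k, Sum.inr l => inferInstanceAs (Decidable (k.val + 1 = l.val))
  | Sum.inl _, Sum.inl _ => inferInstanceAs (Decidable False)
  | Sum.inr _, Sum.inl _ => inferInstanceAs (Decidable False)

/-- The tree `C_{5,m}`: a path `P_{m+1}` on `m + 1` vertices, with each of its two ends identified
with the center of a star with two leaves. -/
def C5 (m : ℕ) : SimpleGraph (C5Vertex m) := SimpleGraph.fromRel (C5Rel m)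

instance (m : ℕ) : DecidableRel (C5 m).Adj :=
  fun a b => inferInstanceAs (Decidable (a ≠ b ∧ (C5Rel m a b ∨ C5Rel m b a)))

/-- The leaf number `i`, so that `v₁, v₂, v₃, v₄` are the leaves `0, 1, 2, 3`. -/
abbrev C5Leaf (m : ℕ) (i : Fin 4) : C5Vertex m := Sum.inl i

/-- The path vertex number `k`, used for `k ≤ m` only. Thus `v₅, v₇, v₉, …, v₁₀, v₈, v₆` are the
path vertices `0, 1, 2, …, m - 2, m - 1, m`. -/
abbrev C5Spine (m k : ℕ) : C5Vertex m := Sum.inr (Fin.ofNat (m + 1) k)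

/-- The vector `d = (2, …, 2)`. -/
def C5d (m : ℕ) : C5Vertex m → ℤ := fun _ => 2

/-- The vector `r = (1, 1, 1, 1, 2, …, 2)`. -/
def C5r (m : ℕ) : C5Vertex m → ℤ := Sum.elim (fun _ => 1) (fun _ => 2)

/-! The ideal of j-minors does not change when a matrix is multiplied by matrices with unit
determinant, and eliminating an n × n block with unit determinant turns (n + j)-minors into j-minors
of the Schur complement (`minorIdeal_fromBlocks`).

In `L(C_{5,m})` take the rows of `v₁` and of the m + 1 path vertices, and the columns of the path
vertices and of `v₄`. In path order this block is lower triangular with -1 on the diagonal, so it is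
unimodular of size m + 2 and only a 3 × 3 matrix remains. In effect `Lz = 0` is solved along the
path: the values at `v₁, v₂, v₃` are free, the other values follow from a three-term recurrence and
are therefore continuants, and the equations at `v₂, v₃, v₄` form the 3 × 3 matrix
(`minorIdeal_C5`). Its 1-minors and 2-minors are computed by hand. Continuants are determinants of
path Laplacians (`det_pathMatrix`), which gives the stated generators. The ideal `I_{m+3}` is proper
because it vanishes modulo m when the leaf variables are 0 and the path variables are 2.

For the group, the pivot-row kernel at `d` is spanned by `r` and two weight vectors. By symmetry of
the Laplacian, pairing with these three vectors decides membership in the image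
(`C5_mem_range_iff`). The torsion is then ℤ² modulo the lattice spanned by (2, 0) and (m, 2), whose
type depends on the parity of m. -/

/-! ### Ideals of minors and unimodular equivalence -/

section MinorIdeal

variable {R U V W : Type*} [CommRing R]

/-- The ideal generated by the `j`-minors of a matrix; rows and columns may be repeated. -/
def minorIdeal (M : Matrix V W R) (j : ℕ) : Ideal R :=
  Ideal.span {p | ∃ (f : Fin j → V) (g : Fin j → W), p = (M.submatrix f g).det}

theorem det_mem_minorIdeal (M : Matrix V W R) {j : ℕ} (f : Fin j → V) (g : Fin j → W) :
    (M.submatrix f g).det ∈ minorIdeal M j :=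
  Ideal.subset_span ⟨f, g, rfl⟩

theorem minorIdeal_le_iff {M : Matrix V W R} {j : ℕ} {I : Ideal R} :
    minorIdeal M j ≤ I ↔ ∀ (f : Fin j → V) (g : Fin j → W), (M.submatrix f g).det ∈ I := by
  refine ⟨fun h f g => h (det_mem_minorIdeal M f g), fun h => Ideal.span_le.2 ?_⟩
  rintro _ ⟨f, g, rfl⟩
  exact h f g

theorem minorIdeal_transpose (M : Matrix V W R) (j : ℕ) :
    minorIdeal M.transpose j = minorIdeal M j := by
  apply le_antisymm <;> rw [minorIdeal_le_iff] <;> intro f g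
  · rw [← Matrix.det_transpose]
    exact det_mem_minorIdeal M g f
  · rw [← Matrix.det_transpose]
    exact det_mem_minorIdeal M.transpose g f

theorem minorIdeal_succ_le (M : Matrix V W R) (j : ℕ) :
    minorIdeal M (j + 1) ≤ minorIdeal M j := by
  rw [minorIdeal_le_iff]
  intro f g
  rw [Matrix.det_succ_row_zero]
  refine Ideal.sum_mem _ fun i _ => Ideal.mul_mem_left _ _ ?_
  exact det_mem_minorIdeal M (f ∘ Fin.succ) (g ∘ i.succAbove)

theorem minorIdeal_antitone (M : Matrix V W R) : Antitone (minorIdeal M) :=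
  antitone_nat_of_succ_le (minorIdeal_succ_le M)

theorem minorIdeal_submatrix_equiv {V' W' : Type*} (M : Matrix V W R) (e : V' ≃ V) (e' : W' ≃ W)
    (j : ℕ) : minorIdeal (M.submatrix e e') j = minorIdeal M j := by
  apply le_antisymm <;> rw [minorIdeal_le_iff] <;> intro f g
  · exact det_mem_minorIdeal M (e ∘ f) (e' ∘ g)
  · have := det_mem_minorIdeal (M.submatrix e e') (e.symm ∘ f) (e'.symm ∘ g)
    simpa [Matrix.submatrix_submatrix, ← Function.comp_assoc] using this

/-- The rows of the product are linear combinations of rows of `M`, so multilinearity expands a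
minor over all row choices `r`. These need not be injective, which is why `minorIdeal` admits
repetitions. -/
theorem minorIdeal_mul_le_right [Fintype V] (P : Matrix U V R) (M : Matrix V W R) (j : ℕ) :
    minorIdeal (P * M) j ≤ minorIdeal M j := by
  classical
  rw [minorIdeal_le_iff]
  intro f g
  have h : ((P * M).submatrix f g).det =
      Matrix.detRowAlternating.toMultilinearMap
        (fun i : Fin j => ∑ v, P (f i) v • fun k => M v (g k)) := by
    change _ = Matrix.det _
    congr 1
    ext i k
    simp [Matrix.mul_apply]
  rw [h, MultilinearMap.map_sum]
  refine Ideal.sum_mem _ fun r _ => ?_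
  rw [MultilinearMap.map_smul_univ]
  exact Ideal.mul_mem_left _ _ (det_mem_minorIdeal M r g)

theorem minorIdeal_mul_le_left [Fintype V] (M : Matrix U V R) (P : Matrix V W R) (j : ℕ) :
    minorIdeal (M * P) j ≤ minorIdeal M j := by
  rw [← minorIdeal_transpose, Matrix.transpose_mul, ← minorIdeal_transpose M]
  exact minorIdeal_mul_le_right _ _ _

theorem minorIdeal_unit_mul [Fintype V] [DecidableEq V] (P : Matrix V V R) (hP : IsUnit P.det)
    (M : Matrix V W R) (j : ℕ) : minorIdeal (P * M) j = minorIdeal M j := by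
  refine le_antisymm (minorIdeal_mul_le_right _ _ _) ?_
  conv_lhs => rw [← Matrix.nonsing_inv_mul_cancel_left P M hP]
  exact minorIdeal_mul_le_right _ _ _

theorem minorIdeal_mul_unit [Fintype V] [DecidableEq V] (M : Matrix U V R) (P : Matrix V V R)
    (hP : IsUnit P.det) (j : ℕ) : minorIdeal (M * P) j = minorIdeal M j := by
  refine le_antisymm (minorIdeal_mul_le_left _ _ _) ?_
  conv_lhs => rw [← Matrix.mul_nonsing_inv_cancel_right P M hP]
  exact minorIdeal_mul_le_left _ _ _

theorem det_submatrix_eq_zero_of_not_injective_left (M : Matrix V W R) {j : ℕ} (f : Fin j → V)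
    (g : Fin j → W) (hf : ¬ Function.Injective f) : (M.submatrix f g).det = 0 := by
  obtain ⟨a, b, hab, hne⟩ : ∃ a b, f a = f b ∧ a ≠ b := by
    simpa [Function.Injective] using hf
  exact Matrix.det_zero_of_row_eq hne (by ext k; simp [hab])

theorem det_submatrix_eq_zero_of_not_injective_right (M : Matrix V W R) {j : ℕ} (f : Fin j → V)
    (g : Fin j → W) (hg : ¬ Function.Injective g) : (M.submatrix f g).det = 0 := by
  rw [← Matrix.det_transpose]
  exact det_submatrix_eq_zero_of_not_injective_left M.transpose g f hg

theorem exists_eq_some_comp {ι X : Type*} (u : ι → Option X) (hu : ∀ i, u i ≠ none) :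
    ∃ u' : ι → X, u = some ∘ u' := by
  choose u' hu' using fun i => Option.ne_none_iff_exists'.1 (hu i)
  exact ⟨u', funext hu'⟩

/-- The first of `n + 1` points is split off from a disjoint union. -/
def optionFinSum (n : ℕ) (X : Type*) : Option (Fin n ⊕ X) → Fin (n + 1) ⊕ X :=
  fun o => o.elim (Sum.inl 0) (Sum.map Fin.succ id)

theorem optionFinSum_bijective (n : ℕ) (X : Type*) : Function.Bijective (optionFinSum n X) := by
  constructor
  · rintro (_ | _ | _) (_ | _ | _) h <;> simp [optionFinSum] at h ⊢
    · exact absurd h.symm (Fin.succ_ne_zero _)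
    · exact h
    · exact h
  · rintro (i | x)
    · refine Fin.cases ⟨none, rfl⟩ (fun k => ⟨some (Sum.inl k), rfl⟩) i
    · exact ⟨some (Sum.inr x), rfl⟩

theorem minorIdeal_option (N : Matrix (Option V) (Option W) R) (h : N none none = 1)
    (hr : ∀ w, N none (some w) = 0) (hc : ∀ v, N (some v) none = 0) (j : ℕ) :
    minorIdeal N (j + 1) = minorIdeal (N.submatrix some some) j := by
  apply le_antisymm <;> rw [minorIdeal_le_iff] <;> intro f g
  · by_cases hf : Function.Injective f
    swap
    · exact det_submatrix_eq_zero_of_not_injective_left N f g hf ▸ zero_mem _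
    by_cases hg : Function.Injective g
    swap
    · exact det_submatrix_eq_zero_of_not_injective_right N f g hg ▸ zero_mem _
    by_cases hf0 : ∃ i, f i = none
    · obtain ⟨i, hi⟩ := hf0
      rw [Matrix.det_succ_row _ i]
      refine Ideal.sum_mem _ fun c _ => ?_
      by_cases hgc : g c = none
      · refine Ideal.mul_mem_left _ _ ?_
        obtain ⟨f', hf'⟩ := exists_eq_some_comp (f ∘ i.succAbove) fun k hk =>
          i.succAbove_ne k (hf (hk.trans hi.symm))
        obtain ⟨g', hg'⟩ := exists_eq_some_comp (g ∘ c.succAbove) fun k hk =>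
          c.succAbove_ne k (hg (hk.trans hgc.symm))
        rw [Matrix.submatrix_submatrix, hf', hg']
        exact det_mem_minorIdeal (N.submatrix some some) f' g'
      · obtain ⟨w, hw⟩ := Option.ne_none_iff_exists'.1 hgc
        simp [hi, hw, hr]
    · push Not at hf0
      obtain ⟨f', rfl⟩ := exists_eq_some_comp f hf0
      by_cases hg0 : ∃ i, g i = none
      · obtain ⟨i, hi⟩ := hg0
        rw [Matrix.det_eq_zero_of_column_eq_zero i (by intro k; simp [hi, hc])]
        exact zero_mem _
      · push Not at hg0
        obtain ⟨g', rfl⟩ := exists_eq_some_comp g hg0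
        exact minorIdeal_succ_le _ _ (det_mem_minorIdeal (N.submatrix some some) f' g')
  · have key := det_mem_minorIdeal N (Fin.cons none (some ∘ f) : Fin (j + 1) → Option V)
      (Fin.cons none (some ∘ g) : Fin (j + 1) → Option W)
    rw [Matrix.det_succ_row_zero, Fin.sum_univ_succ] at key
    simpa [hr, h, Matrix.submatrix_submatrix, Function.comp_def] using key

theorem minorIdeal_fromBlocks_one (n : ℕ) (S : Matrix V W R) (j : ℕ) :
    minorIdeal (Matrix.fromBlocks (1 : Matrix (Fin n) (Fin n) R) 0 0 S) (n + j) =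
      minorIdeal S j := by
  induction n with
  | zero =>
    rw [Nat.zero_add, ← minorIdeal_submatrix_equiv _ (Equiv.emptySum (Fin 0) V).symm
      (Equiv.emptySum (Fin 0) W).symm]
    rfl
  | succ n ih =>
    rw [← ih, Nat.add_right_comm,
      ← minorIdeal_submatrix_equiv _ (Equiv.ofBijective _ (optionFinSum_bijective n V))
        (Equiv.ofBijective _ (optionFinSum_bijective n W)), minorIdeal_option]
    · congr 1
      ext (a | a) (b | b) <;> simp [optionFinSum, Matrix.one_apply]
    · simp [optionFinSum]
    · rintro (b | b) <;> simp [optionFinSum, (Fin.succ_ne_zero _).symm]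
    · rintro (b | b) <;> simp [optionFinSum]

/-- Block elimination by `P` and `Q`, both of unit determinant. Asking for a solution `Z` of `D * Z
= B` lets an explicit solution be supplied without inverting `D`. -/
theorem minorIdeal_fromBlocks [Fintype V] [DecidableEq V] [Fintype W] [DecidableEq W] {n : ℕ}
    (D : Matrix (Fin n) (Fin n) R) (B : Matrix (Fin n) W R) (C : Matrix V (Fin n) R)
    (E : Matrix V W R) (Z : Matrix (Fin n) W R) (hD : IsUnit D.det) (hZ : D * Z = B) (j : ℕ) :
    minorIdeal (Matrix.fromBlocks D B C E) (n + j) = minorIdeal (E - C * Z) j := by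
  let P : Matrix (Fin n ⊕ V) (Fin n ⊕ V) R := Matrix.fromBlocks D⁻¹ 0 (-(C * D⁻¹)) 1
  let Q : Matrix (Fin n ⊕ W) (Fin n ⊕ W) R := Matrix.fromBlocks 1 (-Z) 0 1
  have h1 : (Matrix.fromBlocks D B C E * Q : Matrix (Fin n ⊕ V) (Fin n ⊕ W) R) =
      Matrix.fromBlocks D 0 C (E - C * Z) := by
    rw [Matrix.fromBlocks_multiply]
    simp [hZ, sub_eq_neg_add]
  have h2 : (P * Matrix.fromBlocks D 0 C (E - C * Z) : Matrix (Fin n ⊕ V) (Fin n ⊕ W) R) =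
      Matrix.fromBlocks 1 0 0 (E - C * Z) := by
    rw [Matrix.fromBlocks_multiply]
    simp [Matrix.mul_assoc, Matrix.nonsing_inv_mul D hD]
  rw [← minorIdeal_fromBlocks_one n (E - C * Z), ← h2, minorIdeal_unit_mul P, ← h1,
    minorIdeal_mul_unit _ Q]
  · simp [Q]
  · simpa [P] using hD

theorem minorIdeal_zero (M : Matrix V W R) : minorIdeal M 0 = ⊤ := by
  rw [Ideal.eq_top_iff_one]
  simpa using det_mem_minorIdeal M (Fin.elim0 : Fin 0 → V) (Fin.elim0 : Fin 0 → W)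

theorem minorIdeal_eq_span_embedding (M : Matrix V W R) (j : ℕ) :
    minorIdeal M j =
      Ideal.span {p | ∃ (f : Fin j ↪ V) (g : Fin j ↪ W), p = (M.submatrix f g).det} := by
  apply le_antisymm
  · rw [minorIdeal_le_iff]
    intro f g
    by_cases hf : Function.Injective f
    swap
    · exact det_submatrix_eq_zero_of_not_injective_left M f g hf ▸ zero_mem _
    by_cases hg : Function.Injective g
    swap
    · exact det_submatrix_eq_zero_of_not_injective_right M f g hg ▸ zero_mem _
    exact Ideal.subset_span ⟨⟨f, hf⟩, ⟨g, hg⟩, rfl⟩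
  · apply Ideal.span_mono
    rintro _ ⟨f, g, rfl⟩
    exact ⟨f, g, rfl⟩

/-- Injections between sets of equal size are bijections, so every nonzero maximal minor is the
determinant up to sign. -/
theorem minorIdeal_card [Fintype V] [DecidableEq V] (M : Matrix V V R) {j : ℕ}
    (h : Fintype.card V = j) : minorIdeal M j = Ideal.span {M.det} := by
  subst h
  apply le_antisymm
  · rw [minorIdeal_eq_span_embedding, Ideal.span_le]
    rintro _ ⟨f, g, rfl⟩
    let ef : Fin (Fintype.card V) ≃ V := Equiv.ofBijective f
      ((Fintype.bijective_iff_injective_and_card f).2 ⟨f.injective, by simp⟩)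
    let eg : Fin (Fintype.card V) ≃ V := Equiv.ofBijective g
      ((Fintype.bijective_iff_injective_and_card g).2 ⟨g.injective, by simp⟩)
    have hs : M.submatrix f g = (M.submatrix id (ef.symm.trans eg)).submatrix ef ef := by
      ext a b
      simp [ef, eg]
    rw [hs, Matrix.det_submatrix_equiv_self, Matrix.det_permute']
    exact Ideal.mul_mem_left _ _ (Ideal.subset_span rfl)
  · rw [Ideal.span_singleton_le_iff_mem,
      ← Matrix.det_submatrix_equiv_self (Fintype.equivFin V).symm]
    exact det_mem_minorIdeal _ _ _

end MinorIdeal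

theorem criticalIdeal_eq_minorIdeal {V : Type*} [DecidableEq V] (G : SimpleGraph V)
    [DecidableRel G.Adj] (j : ℕ) : criticalIdeal G j = minorIdeal (genLaplacianX G) j :=
  (minorIdeal_eq_span_embedding _ _).symm

/-! ### Continuants and determinants of paths -/

section Continuant

variable {R : Type*} [CommRing R]

/-- The continuant of `y i, …, y (i + n - 1)` with all off-diagonal products equal to `1`. -/
def pathContinuant (y : ℕ → R) : ℕ → ℕ → R
  | _, 0 => 1
  | i, 1 => y i
  | i, n + 2 => y i * pathContinuant y (i + 1) (n + 1) - pathContinuant y (i + 2) n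

theorem pathContinuant_succ_succ (y : ℕ → R) (i n : ℕ) : pathContinuant y i (n + 2) =
    y i * pathContinuant y (i + 1) (n + 1) - pathContinuant y (i + 2) n := by
  rw [pathContinuant]

/-- Symmetry of continuants: they may equally be expanded at the last variable. This is the
recurrence met when solving along the path from its first end. -/
theorem pathContinuant_succ_succ' (y : ℕ → R) (i n : ℕ) : pathContinuant y i (n + 2) =
    y (i + n + 1) * pathContinuant y i (n + 1) - pathContinuant y i n := by
  induction n using Nat.strong_induction_on generalizing i with
  | _ n ih =>
    match n with
    | 0 => simp [pathContinuant, mul_comm]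
    | 1 => simp [pathContinuant]; ring
    | n + 2 =>
      have h1 := ih (n + 1) (by omega) (i + 1)
      have h2 := ih n (by omega) (i + 2)
      rw [show i + 1 + (n + 1) + 1 = i + (n + 2) + 1 by omega] at h1
      rw [show i + 2 + n + 1 = i + (n + 2) + 1 by omega] at h2
      rw [pathContinuant_succ_succ, h1, h2, pathContinuant_succ_succ y i (n + 1),
        pathContinuant_succ_succ y i n]
      ring

/-- The generalized Laplacian matrix of a path, with `y i, …, y (i + n - 1)` on the diagonal. -/
def pathMatrix (y : ℕ → R) (i n : ℕ) : Matrix (Fin n) (Fin n) R :=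
  Matrix.of fun a b => if a.val = b.val then y (i + a) else
    if a.val + 1 = b.val ∨ b.val + 1 = a.val then -1 else 0

theorem det_pathMatrix (y : ℕ → R) (i n : ℕ) : (pathMatrix y i n).det = pathContinuant y i n := by
  induction n using Nat.strong_induction_on generalizing i with
  | _ n ih =>
    match n with
    | 0 => simp [pathContinuant]
    | 1 => simp [pathContinuant, pathMatrix]
    | n + 2 =>
      have h1 : (pathMatrix y i (n + 2)).submatrix Fin.succ (Fin.succAbove 0) =
          pathMatrix y (i + 1) (n + 1) := by
        ext a b
        simp [pathMatrix, Nat.add_right_comm, ← add_assoc]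
      have h2 : ((pathMatrix y i (n + 2)).submatrix Fin.succ (Fin.succAbove 1)).det =
          - pathContinuant y (i + 2) n := by
        have h3 : ((pathMatrix y i (n + 2)).submatrix Fin.succ (Fin.succAbove 1)).submatrix
            (Fin.succAbove 0) Fin.succ = pathMatrix y (i + 2) n := by
          ext a b
          have : Fin.succAbove 1 b.succ = b.succ.succ := by
            rw [← Fin.succ_zero_eq_one, Fin.succ_succAbove_succ]; simp
          simp [pathMatrix, this]
          simp only [show i + (a.val + 1 + 1) = i + 2 + a by omega]
        rw [Matrix.det_succ_column_zero, Fin.sum_univ_succ, Finset.sum_eq_zero]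
        · rw [h3, ih n (by omega)]
          simp [pathMatrix]
        · intro a _
          simp [pathMatrix]
      rw [Matrix.det_succ_row_zero, Fin.sum_univ_succ, Fin.sum_univ_succ, Finset.sum_eq_zero, h1,
        Fin.succ_zero_eq_one, h2, ih (n + 1) (by omega), pathContinuant_succ_succ]
      · simp [pathMatrix]; ring
      · intro a _
        simp [pathMatrix]

theorem map_pathContinuant {S : Type*} [CommRing S] (φ : R →+* S) (y : ℕ → R) (i n : ℕ) :
    φ (pathContinuant y i n) = pathContinuant (fun k => φ (y k)) i n := by
  induction n using Nat.strong_induction_on generalizing i with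
  | _ n ih =>
    match n with
    | 0 => simp [pathContinuant]
    | 1 => simp [pathContinuant]
    | n + 2 => simp [pathContinuant, ih n (by omega), ih (n + 1) (by omega)]

theorem pathContinuant_two (i n : ℕ) : pathContinuant (fun _ => (2 : R)) i n = n + 1 := by
  induction n using Nat.strong_induction_on generalizing i with
  | _ n ih =>
    match n with
    | 0 => simp [pathContinuant]
    | 1 => simp [pathContinuant]; norm_num
    | n + 2 =>
      simp only [pathContinuant, ih n (by omega), ih (n + 1) (by omega)]
      push_cast
      ring

/-- The continuant of `y 1, …, y (k - 1)`, which is `0` for `k = 0`. -/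
def shiftedContinuant (y : ℕ → R) : ℕ → R
  | 0 => 0
  | k + 1 => pathContinuant y 1 k

/-- The value 0 at k = 0 plays the role of a continuant of length -1; with it the recurrence already
holds from k = 0. -/
theorem shiftedContinuant_succ_succ (y : ℕ → R) (k : ℕ) : shiftedContinuant y (k + 2) =
    y (k + 1) * shiftedContinuant y (k + 1) - shiftedContinuant y k := by
  cases k with
  | zero => simp [shiftedContinuant, pathContinuant]
  | succ k => simp [shiftedContinuant, pathContinuant_succ_succ', add_comm 1 k]

end Continuant

/-! ### The tree and its path determinants -/

theorem pathDet_eq_det_submatrix {V : Type*} [Fintype V] [DecidableEq V] (G : SimpleGraph V)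
    [DecidableRel G.Adj] {u v : V} {n : ℕ} (f : Fin n → V) (hf : Function.Injective f)
    (hr : Set.range f = pathVertices G u v) :
    pathDet G u v = ((genLaplacianX G).submatrix f f).det := by
  classical
  let e : Fin n ≃ pathVertices G u v := (Equiv.ofInjective f hf).trans (Equiv.setCongr hr)
  rw [pathDet, ← Matrix.det_submatrix_equiv_self e]
  rfl

theorem pathVertices_eq_of_isPath {V : Type*} {G : SimpleGraph V} (hG : G.IsAcyclic) {u v : V}
    (p : G.Walk u v) (hp : p.IsPath) : pathVertices G u v = {w | w ∈ p.support} := by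
  ext w
  refine ⟨?_, fun h => ⟨p, hp, h⟩⟩
  rintro ⟨q, hq, hw⟩
  obtain rfl : p = q := congrArg Subtype.val
    ((hG.subsingleton_path u v).elim ⟨p, hp⟩ ⟨q, hq⟩)
  exact hw

section C5Graph

variable {m : ℕ}

theorem C5Spine_val {k : ℕ} (hk : k ≤ m) : (Fin.ofNat (m + 1) k).val = k := by
  simp [Fin.ofNat, Nat.mod_eq_of_lt (Nat.lt_succ_of_le hk)]

theorem C5Spine_injOn : Set.InjOn (C5Spine m) {k | k ≤ m} := by
  intro a ha b hb h
  have := congrArg Fin.val (Sum.inr_injective h)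
  rwa [C5Spine_val ha, C5Spine_val hb] at this

theorem C5Spine_surj (k : Fin (m + 1)) : (Sum.inr k : C5Vertex m) = C5Spine m k := by
  congr 1
  ext
  rw [C5Spine_val (by omega)]

theorem C5_adj_leaf_leaf (i j : Fin 4) : ¬ (C5 m).Adj (Sum.inl i) (Sum.inl j) := by
  simp [C5, C5Rel]

theorem C5_adj_leaf_spine (i : Fin 4) (k : Fin (m + 1)) : (C5 m).Adj (Sum.inl i) (Sum.inr k) ↔
    (i.val < 2 ∧ k.val = 0) ∨ (2 ≤ i.val ∧ k.val = m) := by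
  simp [C5, C5Rel]

theorem C5_adj_spine_leaf (i : Fin 4) (k : Fin (m + 1)) : (C5 m).Adj (Sum.inr k) (Sum.inl i) ↔
    (i.val < 2 ∧ k.val = 0) ∨ (2 ≤ i.val ∧ k.val = m) := by
  rw [SimpleGraph.adj_comm, C5_adj_leaf_spine]

theorem C5_adj_spine_spine (k l : Fin (m + 1)) : (C5 m).Adj (Sum.inr k) (Sum.inr l) ↔
    k.val + 1 = l.val ∨ l.val + 1 = k.val := by
  simp only [C5, SimpleGraph.fromRel_adj, C5Rel, ne_eq, Sum.inr.injEq, and_iff_right_iff_imp]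
  rintro h rfl
  omega

theorem C5_adj_spine_succ {k : ℕ} (hk : k + 1 ≤ m) :
    (C5 m).Adj (C5Spine m k) (C5Spine m (k + 1)) := by
  rw [C5_adj_spine_spine, C5Spine_val hk, C5Spine_val (by omega)]
  exact Or.inl rfl

theorem C5_reachable_spine {k : ℕ} (hk : k ≤ m) :
    (C5 m).Reachable (C5Spine m 0) (C5Spine m k) := by
  induction k with
  | zero => exact SimpleGraph.Reachable.refl _
  | succ k ih => exact (ih (by omega)).trans (C5_adj_spine_succ hk).reachable

theorem C5_connected : (C5 m).Connected := by
  rw [SimpleGraph.connected_iff_exists_forall_reachable]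
  refine ⟨C5Spine m 0, ?_⟩
  rintro (i | k)
  · by_cases hi : i.val < 2
    · refine SimpleGraph.Adj.reachable ?_
      rw [C5_adj_spine_leaf, C5Spine_val (by omega)]
      exact Or.inl ⟨hi, rfl⟩
    · refine (C5_reachable_spine le_rfl).trans (SimpleGraph.Adj.reachable ?_)
      rw [C5_adj_spine_leaf, C5Spine_val le_rfl]
      exact Or.inr ⟨by omega, rfl⟩
  · rw [C5Spine_surj]
    exact C5_reachable_spine (by omega)

/-- The neighbour of a vertex in the direction of the first vertex of the path. -/
def C5Parent (m : ℕ) : C5Vertex m → C5Vertex m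
  | Sum.inl i => if i.val < 2 then C5Spine m 0 else C5Spine m m
  | Sum.inr k => C5Spine m (k.val - 1)

theorem C5_edge_eq (u v : C5Vertex m) (h : (C5 m).Adj u v) :
    (u ≠ C5Spine m 0 ∧ v = C5Parent m u) ∨ (v ≠ C5Spine m 0 ∧ u = C5Parent m v) := by
  have key : ∀ (i : Fin 4) (k : Fin (m + 1)), (C5 m).Adj (Sum.inl i) (Sum.inr k) →
      Sum.inr k = C5Parent m (Sum.inl i) := by
    intro i k h
    rw [C5_adj_leaf_spine] at h
    rw [C5Spine_surj]
    rcases h with ⟨h1, h2⟩ | ⟨h1, h2⟩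
    · simp [C5Parent, h1, h2]
    · simp [C5Parent, Nat.not_lt.2 h1, h2]
  have key' : ∀ k l : Fin (m + 1), k.val + 1 = l.val →
      (Sum.inr l : C5Vertex m) ≠ C5Spine m 0 ∧ Sum.inr k = C5Parent m (Sum.inr l) := by
    intro k l h
    constructor
    · intro h'
      have := congrArg Fin.val (Sum.inr_injective h')
      rw [C5Spine_val (by omega)] at this
      omega
    · rw [C5Spine_surj, C5Parent, ← h, Nat.add_sub_cancel]
  rcases u with i | k <;> rcases v with j | l
  · exact absurd h (C5_adj_leaf_leaf i j)
  · exact Or.inl ⟨by simp, key i l h⟩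
  · exact Or.inr ⟨by simp, key j k h.symm⟩
  · rcases (C5_adj_spine_spine k l).1 h with h | h
    · exact Or.inr (key' k l h)
    · exact Or.inl (key' l k h)

/-- Every edge joins a vertex other than the root `C5Spine m 0` to its parent, so there are at most
|V| - 1 edges; a connected graph with so few edges is a tree. -/
theorem C5_isTree : (C5 m).IsTree := by
  rw [SimpleGraph.isTree_iff_connected_and_card]
  refine ⟨C5_connected, le_antisymm ?_ C5_connected.card_vert_le_card_edgeSet_add_one⟩
  have hsub : (C5 m).edgeSet ⊆
      (fun v => s(v, C5Parent m v)) '' (({C5Spine m 0} : Set (C5Vertex m))ᶜ) := by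
    intro e he
    induction e with
    | _ u v =>
      rcases C5_edge_eq u v he with ⟨h1, h2⟩ | ⟨h1, h2⟩
      · exact ⟨u, h1, by rw [h2]⟩
      · exact ⟨v, h1, by rw [h2, Sym2.eq_swap]⟩
  have h1 : (C5 m).edgeSet.ncard ≤ (({C5Spine m 0} : Set (C5Vertex m))ᶜ).ncard :=
    (Set.ncard_le_ncard hsub).trans (Set.ncard_image_le (Set.toFinite _))
  have h2 := Set.ncard_add_ncard_compl ({C5Spine m 0} : Set (C5Vertex m))
  rw [Set.ncard_singleton] at h2
  rw [Nat.card_coe_set_eq]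
  omega

theorem C5_exists_spine_path (d : ℕ) : ∀ i j : ℕ, i + d = j → j ≤ m →
    ∃ p : (C5 m).Walk (C5Spine m i) (C5Spine m j), p.IsPath ∧
      ∀ w, w ∈ p.support ↔ ∃ k, i ≤ k ∧ k ≤ j ∧ C5Spine m k = w := by
  induction d with
  | zero =>
    rintro i j rfl hj
    refine ⟨SimpleGraph.Walk.nil, SimpleGraph.Walk.IsPath.nil, fun w => ?_⟩
    rw [SimpleGraph.Walk.support_nil, List.mem_singleton]
    constructor
    · rintro rfl
      exact ⟨i, le_rfl, le_rfl, rfl⟩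
    · rintro ⟨k, h1, h2, rfl⟩
      rw [le_antisymm h2 h1]
      rfl
  | succ d ih =>
    intro i j hij hj
    obtain ⟨p, hp, hs⟩ := ih (i + 1) j (by omega) hj
    refine ⟨SimpleGraph.Walk.cons (C5_adj_spine_succ (by omega)) p, ?_, fun w => ?_⟩
    · rw [SimpleGraph.Walk.cons_isPath_iff]
      refine ⟨hp, fun h => ?_⟩
      obtain ⟨k, h1, h2, h3⟩ := (hs _).1 h
      have := C5Spine_injOn (show k ≤ m by omega) (show i ≤ m by omega) h3
      omega
    · rw [SimpleGraph.Walk.support_cons, List.mem_cons, hs]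
      constructor
      · rintro (rfl | ⟨k, h1, h2, h3⟩)
        · exact ⟨i, le_rfl, by omega, rfl⟩
        · exact ⟨k, by omega, h2, h3⟩
      · rintro ⟨k, h1, h2, rfl⟩
        rcases h1.eq_or_lt with rfl | h1
        · exact Or.inl rfl
        · exact Or.inr ⟨k, h1, h2, rfl⟩

/-- The variable of the path vertex number `k`. -/
noncomputable def C5Var (m k : ℕ) : MvPolynomial (C5Vertex m) ℤ := MvPolynomial.X (C5Spine m k)

theorem C5_pathDet_spine {i n : ℕ} (h : i + n ≤ m) :
    pathDet (C5 m) (C5Spine m i) (C5Spine m (i + n)) =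
      pathContinuant (C5Var m) i (n + 1) := by
  obtain ⟨p, hp, hs⟩ := C5_exists_spine_path n i (i + n) rfl h
  rw [pathDet_eq_det_submatrix (C5 m) (fun a : Fin (n + 1) => C5Spine m (i + a)),
    ← det_pathMatrix]
  · congr 1
    ext1 a b
    have hadj := C5_adj_spine_spine (Fin.ofNat (m + 1) (i + a)) (Fin.ofNat (m + 1) (i + b))
    rw [C5Spine_val (by omega), C5Spine_val (by omega)] at hadj
    have heq : C5Spine m (i + a) = C5Spine m (i + b) ↔ a.val = b.val :=
      ⟨fun h' => by
        have := C5Spine_injOn (show i + a.val ≤ m by omega) (show i + b.val ≤ m by omega) h'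
        omega, fun h' => by rw [h']⟩
    simp only [Matrix.submatrix_apply, genLaplacianX, genLaplacian, Matrix.sub_apply,
      Matrix.diagonal_apply, heq, SimpleGraph.adjMatrix_apply, hadj, pathMatrix, Matrix.of_apply,
      C5Var]
    split_ifs <;> first | omega | simp
  · intro a b hab
    have := C5Spine_injOn (show i + a.val ≤ m by omega) (show i + b.val ≤ m by omega) hab
    exact Fin.ext (by omega)
  · rw [pathVertices_eq_of_isPath C5_isTree.isAcyclic p hp]
    ext w
    rw [Set.mem_ofPred_eq, hs]
    constructor
    · rintro ⟨a, rfl⟩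
      exact ⟨i + a, by omega, by omega, rfl⟩
    · rintro ⟨k, h1, h2, rfl⟩
      exact ⟨⟨k - i, by omega⟩, by simp [Nat.add_sub_cancel' h1]⟩

theorem C5_pathDet_leaves {a b : Fin 4} (hab : a ≠ b) {k : ℕ}
    (ha : (C5 m).Adj (Sum.inl a) (C5Spine m k)) (hb : (C5 m).Adj (Sum.inl b) (C5Spine m k)) :
    pathDet (C5 m) (C5Leaf m a) (C5Leaf m b) =
      MvPolynomial.X (C5Leaf m a) * MvPolynomial.X (C5Leaf m b) * C5Var m k
        - MvPolynomial.X (C5Leaf m a) - MvPolynomial.X (C5Leaf m b) := by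
  rw [pathDet_eq_det_submatrix (C5 m) ![C5Leaf m a, C5Spine m k, C5Leaf m b]]
  · rw [Matrix.det_fin_three]
    simp [genLaplacianX, genLaplacian, ha, hb, ha.symm, hb.symm,
      C5_adj_leaf_leaf, hab, hab.symm, C5Var]
    ring
  · intro i j
    fin_cases i <;> fin_cases j <;> simp [hab, hab.symm]
  · rw [pathVertices_eq_of_isPath C5_isTree.isAcyclic
      (SimpleGraph.Walk.cons ha (SimpleGraph.Walk.cons hb.symm SimpleGraph.Walk.nil))]
    · ext w
      simp only [Matrix.range_cons, Matrix.range_empty, Set.union_empty, Set.mem_union,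
        Set.mem_singleton_iff, SimpleGraph.Walk.support_cons, SimpleGraph.Walk.support_nil,
        Set.mem_ofPred_eq, List.mem_cons, List.not_mem_nil, or_false]
    · simp [SimpleGraph.Walk.cons_isPath_iff, hab]

/-! ### Rows of the generalized Laplacian -/

theorem genLaplacian_mulVec_apply {V R : Type*} [Fintype V] [DecidableEq V] [CommRing R]
    (G : SimpleGraph V) [DecidableRel G.Adj] (x z : V → R) (v : V) (s : Finset V)
    (hs : ∀ u, G.Adj v u ↔ u ∈ s) :
    (genLaplacian G x).mulVec z v = x v * z v - ∑ u ∈ s, z u := by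
  have : G.neighborFinset v = s := by
    ext u
    rw [SimpleGraph.mem_neighborFinset, hs]
  rw [genLaplacian, Matrix.sub_mulVec, Pi.sub_apply, Matrix.mulVec_diagonal,
    SimpleGraph.adjMatrix_mulVec_apply, this]

theorem C5Spine_eq_iff {k : ℕ} (hk : k ≤ m) (l : Fin (m + 1)) :
    (Sum.inr l : C5Vertex m) = C5Spine m k ↔ l.val = k := by
  rw [Sum.inr.injEq, Fin.ext_iff, C5Spine_val hk]

variable {R : Type*} [CommRing R] (x z : C5Vertex m → R)

theorem C5_mulVec_leaf_first {i : Fin 4} (hi : i.val < 2) :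
    (genLaplacian (C5 m) x).mulVec z (Sum.inl i) =
      x (Sum.inl i) * z (Sum.inl i) - z (C5Spine m 0) := by
  rw [genLaplacian_mulVec_apply _ _ _ _ {C5Spine m 0}, Finset.sum_singleton]
  rintro (j | l)
  · simp [C5_adj_leaf_leaf]
  · rw [C5_adj_leaf_spine, Finset.mem_singleton, C5Spine_eq_iff (by omega)]
    omega

theorem C5_mulVec_leaf_last {i : Fin 4} (hi : 2 ≤ i.val) :
    (genLaplacian (C5 m) x).mulVec z (Sum.inl i) =
      x (Sum.inl i) * z (Sum.inl i) - z (C5Spine m m) := by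
  rw [genLaplacian_mulVec_apply _ _ _ _ {C5Spine m m}, Finset.sum_singleton]
  rintro (j | l)
  · simp [C5_adj_leaf_leaf]
  · rw [C5_adj_leaf_spine, Finset.mem_singleton, C5Spine_eq_iff (by omega)]
    omega

theorem C5_mulVec_spine_first (hm : 1 ≤ m) :
    (genLaplacian (C5 m) x).mulVec z (C5Spine m 0) = x (C5Spine m 0) * z (C5Spine m 0) -
      (z (C5Leaf m 0) + (z (C5Leaf m 1) + z (C5Spine m 1))) := by
  rw [genLaplacian_mulVec_apply _ _ _ _ {C5Leaf m 0, C5Leaf m 1, C5Spine m 1},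
    Finset.sum_insert (by simp), Finset.sum_insert (by simp), Finset.sum_singleton]
  rintro (j | l)
  · rw [C5_adj_spine_leaf, C5Spine_val (by omega)]
    fin_cases j <;> simp
    omega
    omega
  · rw [C5_adj_spine_spine, C5Spine_val (by omega)]
    simp only [Finset.mem_insert, Finset.mem_singleton, C5Spine_eq_iff hm, C5Leaf,
      reduceCtorEq, false_or, or_false]
    omega

theorem C5_mulVec_spine_last {n : ℕ} (hm : m = n + 1) :
    (genLaplacian (C5 m) x).mulVec z (C5Spine m m) = x (C5Spine m m) * z (C5Spine m m) -
      (z (C5Leaf m 2) + (z (C5Leaf m 3) + z (C5Spine m n))) := by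
  rw [genLaplacian_mulVec_apply _ _ _ _ {C5Leaf m 2, C5Leaf m 3, C5Spine m n},
    Finset.sum_insert (by simp), Finset.sum_insert (by simp), Finset.sum_singleton]
  rintro (j | l)
  · rw [C5_adj_spine_leaf, C5Spine_val (by omega)]
    fin_cases j <;> simp
    omega
    omega
  · rw [C5_adj_spine_spine, C5Spine_val (by omega)]
    simp only [Finset.mem_insert, Finset.mem_singleton, C5Spine_eq_iff (show n ≤ m by omega),
      C5Leaf, reduceCtorEq, false_or]
    omega

theorem C5_mulVec_spine {k : ℕ} (hk : k + 2 ≤ m) :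
    (genLaplacian (C5 m) x).mulVec z (C5Spine m (k + 1)) =
      x (C5Spine m (k + 1)) * z (C5Spine m (k + 1)) -
        (z (C5Spine m k) + z (C5Spine m (k + 2))) := by
  have hne : C5Spine m k ≠ C5Spine m (k + 2) := fun h => by
    have := C5Spine_injOn (show k ≤ m by omega) (show k + 2 ≤ m by omega) h
    omega
  rw [genLaplacian_mulVec_apply _ _ _ _ {C5Spine m k, C5Spine m (k + 2)},
    Finset.sum_pair hne]
  rintro (j | l)
  · rw [C5_adj_spine_leaf, C5Spine_val (by omega)]
    simp
    omega
  · rw [C5_adj_spine_spine, C5Spine_val (by omega)]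
    simp only [Finset.mem_insert, Finset.mem_singleton, C5Spine_eq_iff hk,
      C5Spine_eq_iff (show k ≤ m by omega)]
    omega

end C5Graph

/-! ### Elimination of a unimodular block -/

/-- If `Y` is the identity on the free columns and is killed by the pivot rows, its pivot part is
-`D⁻¹B`. The other rows of `M * Y` are then exactly the Schur complement. -/
theorem minorIdeal_eq_of_mul {R V K : Type*} [CommRing R] [Fintype V] [DecidableEq V] [Fintype K]
    [DecidableEq K] {n : ℕ} (M : Matrix V V R) (eR eC : Fin n ⊕ K ≃ V)
    (hD : IsUnit (M.submatrix (eR ∘ Sum.inl) (eC ∘ Sum.inl)).det) (Y : Matrix V K R)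
    (hY : ∀ i j, Y (eC (Sum.inr i)) j = if i = j then 1 else 0)
    (h0 : ∀ k j, (M * Y) (eR (Sum.inl k)) j = 0) (j : ℕ) :
    minorIdeal M (n + j) = minorIdeal ((M * Y).submatrix (eR ∘ Sum.inr) id) j := by
  have key : ∀ a j, (M * Y) (eR a) j =
      ∑ k, M (eR a) (eC (Sum.inl k)) * Y (eC (Sum.inl k)) j + M (eR a) (eC (Sum.inr j)) := by
    intro a j
    rw [Matrix.mul_apply, ← eC.sum_comp, Fintype.sum_sum_type]
    simp [hY]
  have hD' : IsUnit (M.submatrix eR eC).toBlocks₁₁.det := hD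
  rw [← minorIdeal_submatrix_equiv M eR eC, ← Matrix.fromBlocks_toBlocks (M.submatrix eR eC),
    minorIdeal_fromBlocks _ _ _ _ (-(Y.submatrix (eC ∘ Sum.inl) id)) hD']
  · congr 1
    ext i j
    simp [Matrix.mul_apply, Matrix.toBlocks₂₁, Matrix.toBlocks₂₂, key, add_comm,
      -Matrix.submatrix_mul_equiv]
  · ext i j
    have := h0 i j
    rw [key] at this
    simp [Matrix.mul_apply, Matrix.toBlocks₁₁, Matrix.toBlocks₁₂]
    exact (eq_neg_of_add_eq_zero_right this).symm

/-! ### Minors of the reduced matrix -/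

section ThreeByThree

variable {R : Type*} [CommRing R] (x₁ x₂ x₃ x₄ A B A' B' : R)

/-- A presentation matrix of the cokernel of the generalized Laplacian of `C_{5,m}`. -/
def C5Reduced : Matrix (Fin 3) (Fin 3) R :=
  !![-x₁, x₂, 0; -(x₁ * A - B), B, x₃; x₄ * (x₁ * A' - B') - (x₁ * A - B), B - x₄ * B', -x₄]

theorem minorIdeal_C5Reduced_one : minorIdeal (C5Reduced x₁ x₂ x₃ x₄ A B A' B') 1 =
    Ideal.span {x₁, x₂, x₃, x₄, B} := by
  apply le_antisymm
  · rw [minorIdeal_le_iff]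
    intro f g
    set J := Ideal.span {x₁, x₂, x₃, x₄, B} with hJ
    have h1 : x₁ ∈ J := Ideal.subset_span (by simp)
    have h2 : x₂ ∈ J := Ideal.subset_span (by simp)
    have h3 : x₃ ∈ J := Ideal.subset_span (by simp)
    have h4 : x₄ ∈ J := Ideal.subset_span (by simp)
    have h5 : B ∈ J := Ideal.subset_span (by simp)
    have h6 : x₁ * A - B ∈ J := sub_mem (J.mul_mem_right _ h1) h5
    rw [Matrix.det_fin_one, Matrix.submatrix_apply]
    generalize f 0 = a
    generalize g 0 = b
    fin_cases a <;> fin_cases b <;> simp only [C5Reduced] <;>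
      first
      | exact h2
      | exact h3
      | exact h5
      | exact zero_mem _
      | exact neg_mem h1
      | exact neg_mem h4
      | exact neg_mem h6
      | exact sub_mem (J.mul_mem_right _ h4) h6
      | exact sub_mem h5 (J.mul_mem_right _ h4)
  · have key : ∀ a b, C5Reduced x₁ x₂ x₃ x₄ A B A' B' a b ∈
        minorIdeal (C5Reduced x₁ x₂ x₃ x₄ A B A' B') 1 := by
      intro a b
      simpa using det_mem_minorIdeal (C5Reduced x₁ x₂ x₃ x₄ A B A' B') (fun _ : Fin 1 => a)
        (fun _ => b)
    rw [Ideal.span_le]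
    rintro y (rfl | rfl | rfl | rfl | rfl)
    · simpa [C5Reduced] using neg_mem (key 0 0)
    · simpa [C5Reduced] using key 0 1
    · simpa [C5Reduced] using key 1 2
    · simpa [C5Reduced] using neg_mem (key 2 2)
    · simpa [C5Reduced] using key 1 1

theorem minorIdeal_two_le {V W : Type*} [LinearOrder V] [LinearOrder W] {M : Matrix V W R}
    {J : Ideal R} (h : ∀ a b c d, a < b → c < d → M a c * M b d - M a d * M b c ∈ J) :
    minorIdeal M 2 ≤ J := by
  have h' : ∀ a b c d, a < b → M a c * M b d - M a d * M b c ∈ J := by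
    intro a b c d hab
    rcases lt_trichotomy c d with hcd | rfl | hcd
    · exact h a b c d hab hcd
    · simp
    · simpa using neg_mem (h a b d c hab hcd)
  rw [minorIdeal_le_iff]
  intro f g
  rw [Matrix.det_fin_two]
  simp only [Matrix.submatrix_apply]
  rcases lt_trichotomy (f 0) (f 1) with hf | hf | hf
  · exact h' _ _ _ _ hf
  · simp [hf, mul_comm]
  · have := neg_mem (h' _ _ (g 0) (g 1) hf)
    convert this using 1
    ring

/-- Four minors are, up to sign, the mixed products of a leaf variable at one end with one at the
other. Modulo these products the remaining minors reduce to the last two generators or to 0. -/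
theorem minorIdeal_C5Reduced_two : minorIdeal (C5Reduced x₁ x₂ x₃ x₄ A B A' B') 2 =
    Ideal.span {x₁ * x₃, x₁ * x₄, x₂ * x₃, x₂ * x₄, x₁ * x₂ * A - (x₁ + x₂) * B,
      x₃ * x₄ * B' - (x₃ + x₄) * B} := by
  apply le_antisymm
  · apply minorIdeal_two_le
    set e := x₁ * x₂ * A - (x₁ + x₂) * B with he
    set f := x₃ * x₄ * B' - (x₃ + x₄) * B with hf
    set J := Ideal.span {x₁ * x₃, x₁ * x₄, x₂ * x₃, x₂ * x₄, e, f} with hJ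
    have h1 : x₁ * x₃ ∈ J := Ideal.subset_span (by simp)
    have h2 : x₁ * x₄ ∈ J := Ideal.subset_span (by simp)
    have h3 : x₂ * x₃ ∈ J := Ideal.subset_span (by simp)
    have h4 : x₂ * x₄ ∈ J := Ideal.subset_span (by simp)
    have h5 : e ∈ J := Ideal.subset_span (by simp)
    have h6 : f ∈ J := Ideal.subset_span (by simp)
    have pairs : ∀ a b : Fin 3, a < b →
        (a = 0 ∧ b = 1) ∨ (a = 0 ∧ b = 2) ∨ (a = 1 ∧ b = 2) := by decide
    intro a b c d hab hcd
    rcases pairs a b hab with ⟨rfl, rfl⟩ | ⟨rfl, rfl⟩ | ⟨rfl, rfl⟩ <;>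
    rcases pairs c d hcd with ⟨rfl, rfl⟩ | ⟨rfl, rfl⟩ | ⟨rfl, rfl⟩ <;>
    simp [C5Reduced, -mul_neg, -neg_mul, -neg_sub, -neg_add_rev]
    · convert h5 using 1
      rw [he]; ring
    · simpa using h1
    · simpa using h3
    · convert add_mem h5 (add_mem (J.mul_mem_left B' h2) (J.mul_mem_left (B' - x₁ * A') h4)) using 1
      rw [he]; ring
    · simpa using h2
    · simpa using h4
    -- The terms `B * x₄ * B'` cancel, leaving a multiple of `x₁ * x₄`.
    · convert J.mul_mem_left (A * B' - B * A') h2 using 1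
      ring
    · convert add_mem h6 (add_mem (J.mul_mem_left (A - x₃ * A') h2) (J.mul_mem_left A h1)) using 1
      rw [hf]; ring
    · convert h6 using 1
      rw [hf]; ring
  · have key : ∀ a b c d, C5Reduced x₁ x₂ x₃ x₄ A B A' B' a c * C5Reduced x₁ x₂ x₃ x₄ A B A' B' b d
        - C5Reduced x₁ x₂ x₃ x₄ A B A' B' a d * C5Reduced x₁ x₂ x₃ x₄ A B A' B' b c ∈
        minorIdeal (C5Reduced x₁ x₂ x₃ x₄ A B A' B') 2 := by
      intro a b c d
      have := det_mem_minorIdeal (C5Reduced x₁ x₂ x₃ x₄ A B A' B') ![a, b] ![c, d]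
      rwa [Matrix.det_fin_two] at this
    rw [Ideal.span_le]
    rintro y (rfl | rfl | rfl | rfl | rfl | rfl)
    · simpa [C5Reduced] using key 0 1 0 2
    · simpa [C5Reduced] using key 0 2 0 2
    · simpa [C5Reduced] using key 0 1 1 2
    · simpa [C5Reduced] using key 0 2 1 2
    · convert key 0 1 0 1 using 1
      simp [C5Reduced]; ring_nf
    · convert key 1 2 1 2 using 1
      simp [C5Reduced]; ring_nf

end ThreeByThree

/-! ### Reduction of the Laplacian to a 3 × 3 matrix -/

section C5Reduction

variable {m : ℕ}

/-- The rows used to eliminate all but three generators, followed by the remaining three. -/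
def C5Row (m : ℕ) : Fin (m + 2) ⊕ Fin 3 → C5Vertex m
  | Sum.inl i => if i.val = 0 then C5Leaf m 0 else C5Spine m (i.val - 1)
  | Sum.inr i => C5Leaf m i.succ

/-- The eliminated generators, followed by the remaining three. -/
def C5Col (m : ℕ) : Fin (m + 2) ⊕ Fin 3 → C5Vertex m
  | Sum.inl i => if i.val ≤ m then C5Spine m i.val else C5Leaf m 3
  | Sum.inr i => C5Leaf m i.castSucc

theorem C5Row_bijective : Function.Bijective (C5Row m) := by
  rw [Fintype.bijective_iff_injective_and_card]
  refine ⟨?_, by simp; omega⟩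
  rintro (i | i) (j | j) h
  · simp only [C5Row] at h
    split_ifs at h with hi hj hj
    · exact congrArg Sum.inl (Fin.ext (hi.trans hj.symm))
    · have := C5Spine_injOn (show i.val - 1 ≤ m by omega) (show j.val - 1 ≤ m by omega) h
      exact congrArg Sum.inl (Fin.ext (by omega))
  · simp only [C5Row] at h
    split_ifs at h with hi
    exact absurd (Sum.inl_injective h).symm (Fin.succ_ne_zero j)
  · simp only [C5Row] at h
    split_ifs at h with hi
    exact absurd (Sum.inl_injective h) (Fin.succ_ne_zero i)
  · exact congrArg Sum.inr (Fin.succ_injective _ (Sum.inl_injective h))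

theorem C5Col_bijective : Function.Bijective (C5Col m) := by
  rw [Fintype.bijective_iff_injective_and_card]
  refine ⟨?_, by simp; omega⟩
  rintro (i | i) (j | j) h
  · simp only [C5Col] at h
    split_ifs at h with hi hj hj
    · exact congrArg Sum.inl (Fin.ext (C5Spine_injOn hi hj h))
    · exact congrArg Sum.inl (Fin.ext (by omega))
  · simp only [C5Col] at h
    split_ifs at h with hi
    have := congrArg Fin.val (Sum.inl_injective h)
    simp at this
    omega
  · simp only [C5Col] at h
    split_ifs at h with hi
    have := congrArg Fin.val (Sum.inl_injective h)
    simp at this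
    omega
  · exact congrArg Sum.inr (Fin.castSucc_injective _ (Sum.inl_injective h))

variable {R : Type*} [CommRing R] (x : C5Vertex m → R)

theorem genLaplacian_apply_of_ne {V : Type*} [DecidableEq V] (G : SimpleGraph V)
    [DecidableRel G.Adj] (x : V → R) {u v : V} (h : u ≠ v) :
    genLaplacian G x u v = if G.Adj u v then -1 else 0 := by
  simp only [genLaplacian, Matrix.sub_apply, Matrix.diagonal_apply_ne _ h,
    SimpleGraph.adjMatrix_apply]
  split_ifs <;> simp

theorem C5_row_col_diag (i : Fin (m + 2)) :
    genLaplacian (C5 m) x (C5Row m (Sum.inl i)) (C5Col m (Sum.inl i)) = -1 := by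
  suffices h : (C5 m).Adj (C5Row m (Sum.inl i)) (C5Col m (Sum.inl i)) by
    rw [genLaplacian_apply_of_ne _ _ h.ne, if_pos h]
  simp only [C5Row, C5Col]
  split_ifs with h1 h2 h2
  · rw [C5_adj_leaf_spine, C5Spine_val (by omega)]
    exact Or.inl ⟨by simp, h1⟩
  · omega
  · rw [C5_adj_spine_spine, C5Spine_val (by omega), C5Spine_val (by omega)]
    omega
  · rw [C5_adj_spine_leaf, C5Spine_val (by omega)]
    exact Or.inr ⟨by simp, by omega⟩

theorem C5_row_col_lt {i j : Fin (m + 2)} (hij : i < j) :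
    genLaplacian (C5 m) x (C5Row m (Sum.inl i)) (C5Col m (Sum.inl j)) = 0 := by
  rw [Fin.lt_def] at hij
  suffices h : C5Row m (Sum.inl i) ≠ C5Col m (Sum.inl j) ∧
      ¬ (C5 m).Adj (C5Row m (Sum.inl i)) (C5Col m (Sum.inl j)) by
    rw [genLaplacian_apply_of_ne _ _ h.1, if_neg h.2]
  simp only [C5Row, C5Col]
  split_ifs with h1 h2 h2
  · rw [C5_adj_leaf_spine, C5Spine_val (by omega)]
    refine ⟨by simp, ?_⟩
    rintro (⟨-, h⟩ | ⟨h, -⟩)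
    · omega
    · exact absurd h (by decide)
  · simp [C5_adj_leaf_leaf]
  · rw [C5_adj_spine_spine, C5Spine_val (by omega), C5Spine_val (by omega), ne_eq,
      C5Spine_eq_iff (by omega), C5Spine_val (by omega)]
    omega
  · rw [C5_adj_spine_leaf, C5Spine_val (by omega)]
    simp
    omega

/-- Each pivot row is matched with its next neighbour along `v₁`, path, `v₄`. The entry there is -1
and later columns vanish, so the block is triangular with determinant ±1. -/
theorem C5_det_pivot_isUnit : IsUnit ((genLaplacian (C5 m) x).submatrix
    (Equiv.ofBijective _ C5Row_bijective ∘ Sum.inl)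
    (Equiv.ofBijective _ C5Col_bijective ∘ Sum.inl)).det := by
  rw [Matrix.det_of_isLowerTriangular]
  · simp only [Matrix.submatrix_apply, Function.comp_apply, Equiv.ofBijective_apply,
      C5_row_col_diag, Finset.prod_const]
    exact IsUnit.pow _ isUnit_one.neg
  · intro i j hij
    exact C5_row_col_lt x (OrderDual.toDual_lt_toDual.1 hij)

/-- The generators of the cokernel of the generalized Laplacian in terms of the first three
leaves. -/
def C5Kernel : Matrix (C5Vertex m) (Fin 3) R :=
  Sum.elim
    ![![1, 0, 0], ![0, 1, 0], ![0, 0, 1],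
      ![x (C5Leaf m 0) * pathContinuant (fun k => x (C5Spine m k)) 0 (m + 1) -
          shiftedContinuant (fun k => x (C5Spine m k)) (m + 1),
        -shiftedContinuant (fun k => x (C5Spine m k)) (m + 1), -1]]
    (fun k => ![x (C5Leaf m 0) * pathContinuant (fun k => x (C5Spine m k)) 0 k -
          shiftedContinuant (fun k => x (C5Spine m k)) k,
        -shiftedContinuant (fun k => x (C5Spine m k)) k, 0])

theorem C5Kernel_spine {k : ℕ} (hk : k ≤ m) : C5Kernel x (C5Spine m k) =
    ![x (C5Leaf m 0) * pathContinuant (fun k => x (C5Spine m k)) 0 k -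
          shiftedContinuant (fun k => x (C5Spine m k)) k,
        -shiftedContinuant (fun k => x (C5Spine m k)) k, 0] := by
  simp only [C5Kernel, Sum.elim_inr, C5Spine_val hk]

/-- Each pivot equation determines the next value: the row of `v₁` gives the first path vertex, each
path row the following vertex, and the last path row gives `v₄`. The entries of `C5Kernel` satisfy
these recurrences. -/
theorem C5Kernel_mul_pivot (hm : 1 ≤ m) (k : Fin (m + 2)) (j : Fin 3) :
    (genLaplacian (C5 m) x * C5Kernel x) (C5Row m (Sum.inl k)) j = 0 := by
  change (genLaplacian (C5 m) x).mulVec (fun u => C5Kernel x u j) _ = 0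
  obtain ⟨n, rfl⟩ : ∃ n, m = n + 1 := ⟨m - 1, by omega⟩
  simp only [C5Row]
  split_ifs with h
  · rw [C5_mulVec_leaf_first _ _ (by simp), C5Kernel_spine x (by omega)]
    fin_cases j <;> simp [C5Kernel, pathContinuant, shiftedContinuant]
  · obtain ⟨k', hk'⟩ : ∃ k', k.val - 1 = k' := ⟨_, rfl⟩
    have hk : k' ≤ n + 1 := by omega
    rw [hk']
    rcases hk.eq_or_lt with rfl | hk
    · rw [C5_mulVec_spine_last x _ rfl, C5Kernel_spine x (by omega), C5Kernel_spine x (by omega)]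
      fin_cases j <;>
        simp [C5Kernel, pathContinuant_succ_succ', shiftedContinuant_succ_succ] <;> ring
    · cases k' with
      | zero =>
        rw [C5_mulVec_spine_first x _ hm, C5Kernel_spine x (by omega), C5Kernel_spine x (by omega)]
        fin_cases j <;> simp [C5Kernel, pathContinuant, shiftedContinuant]
        ring
      | succ k' =>
        rw [C5_mulVec_spine x _ (by omega), C5Kernel_spine x (by omega),
          C5Kernel_spine x (by omega), C5Kernel_spine x (by omega)]
        fin_cases j <;>
          simp [pathContinuant_succ_succ', shiftedContinuant_succ_succ] <;> ring

/-- The reduced matrix with the values of the continuants of the path of `C_{5,m}`. -/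
def C5ReducedOf : Matrix (Fin 3) (Fin 3) R :=
  C5Reduced (x (C5Leaf m 0)) (x (C5Leaf m 1)) (x (C5Leaf m 2)) (x (C5Leaf m 3))
    (pathContinuant (fun k => x (C5Spine m k)) 0 m)
    (shiftedContinuant (fun k => x (C5Spine m k)) m)
    (pathContinuant (fun k => x (C5Spine m k)) 0 (m + 1))
    (shiftedContinuant (fun k => x (C5Spine m k)) (m + 1))

theorem C5Kernel_mul_leaf (i j : Fin 3) :
    (genLaplacian (C5 m) x * C5Kernel x) (C5Leaf m i.succ) j = C5ReducedOf x i j := by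
  change (genLaplacian (C5 m) x).mulVec (fun u => C5Kernel x u j) (Sum.inl i.succ) = _
  fin_cases i
  · rw [C5_mulVec_leaf_first _ _ (by simp), C5Kernel_spine x (by omega)]
    fin_cases j <;> simp [C5Kernel, C5ReducedOf, C5Reduced, pathContinuant, shiftedContinuant]
  · rw [C5_mulVec_leaf_last _ _ (by simp), C5Kernel_spine x (by omega)]
    fin_cases j <;> simp [C5Kernel, C5ReducedOf, C5Reduced]
  · rw [C5_mulVec_leaf_last _ _ (by simp), C5Kernel_spine x (by omega)]
    fin_cases j <;> simp [C5Kernel, C5ReducedOf, C5Reduced]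
    ring

theorem minorIdeal_C5 (hm : 1 ≤ m) (j : ℕ) :
    minorIdeal (genLaplacian (C5 m) x) (m + 2 + j) = minorIdeal (C5ReducedOf x) j := by
  rw [minorIdeal_eq_of_mul _ _ _ (C5_det_pivot_isUnit x) (C5Kernel x)]
  · congr 1
    ext i j
    exact C5Kernel_mul_leaf x i j
  · intro i j
    fin_cases i <;> fin_cases j <;> simp [C5Col, C5Kernel]
  · exact fun k j => C5Kernel_mul_pivot x hm k j

end C5Reduction

/-! ### The critical group -/

theorem exists_mulVec_eq_on_pivots {R V K : Type*} [CommRing R] [Fintype V] [DecidableEq V]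
    [Fintype K] {n : ℕ} (M : Matrix V V R) (eR eC : Fin n ⊕ K ≃ V)
    (hD : IsUnit (M.submatrix (eR ∘ Sum.inl) (eC ∘ Sum.inl)).det) (x : V → R) :
    ∃ z : V → R, ∀ k, M.mulVec z (eR (Sum.inl k)) = x (eR (Sum.inl k)) := by
  set D := M.submatrix (eR ∘ Sum.inl) (eC ∘ Sum.inl) with hDdef
  let c := D⁻¹.mulVec fun k => x (eR (Sum.inl k))
  refine ⟨fun v => Sum.elim c (fun _ => 0) (eC.symm v), fun k => ?_⟩
  have h : D.mulVec c k = x (eR (Sum.inl k)) := by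
    simp only [c, Matrix.mulVec_mulVec, Matrix.mul_nonsing_inv D hD, Matrix.one_mulVec]
  rw [← h, Matrix.mulVec, dotProduct, ← eC.sum_comp, Fintype.sum_sum_type]
  simp [Matrix.mulVec, dotProduct, hDdef]

/-- Since ℤ has no torsion, `d` vanishes on torsion classes, and there `t` is injective. Conversely,
a class in the kernel of `d` is killed by `e`, because `e` kills `T`. -/
theorem nonempty_torsion_quotient_addEquiv {M T : Type*} [AddCommGroup M] [AddCommGroup T]
    (N : Submodule ℤ M) (d : M →ₗ[ℤ] ℤ) (t : M →ₗ[ℤ] T) (hN : ∀ x, x ∈ N ↔ d x = 0 ∧ t x = 0)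
    (ht : ∀ y : T, ∃ x, d x = 0 ∧ t x = y) {e : ℤ} (he : e ≠ 0) (hT : ∀ y : T, e • y = 0) :
    Nonempty (Submodule.torsion ℤ (M ⧸ N) ≃+ T) := by
  let f : Submodule.torsion ℤ (M ⧸ N) →ₗ[ℤ] T :=
    (N.liftQ t fun x hx => ((hN x).1 hx).2).comp (Submodule.subtype _)
  refine ⟨AddEquiv.ofBijective f.toAddMonoidHom ⟨?_, fun y => ?_⟩⟩
  · rw [injective_iff_map_eq_zero]
    rintro ⟨q, hq⟩ h
    obtain ⟨x, rfl⟩ := N.mkQ_surjective q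
    obtain ⟨a, ha⟩ := (Submodule.mem_torsion_iff _).1 hq
    have ht' : t x = 0 := h
    have ha' : (a : ℤ) • x ∈ N := (Submodule.Quotient.mk_eq_zero N).1 ha
    have hd := ((hN _).1 ha').1
    rw [map_smul, smul_eq_mul] at hd
    have hd' : d x = 0 := (mul_eq_zero.1 hd).resolve_left (nonZeroDivisors.coe_ne_zero a)
    exact Subtype.ext ((Submodule.Quotient.mk_eq_zero N).2 ((hN x).2 ⟨hd', ht'⟩))
  · obtain ⟨x, hx, rfl⟩ := ht y
    refine ⟨⟨N.mkQ x, (Submodule.mem_torsion_iff _).2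
      ⟨⟨e, mem_nonZeroDivisors_of_ne_zero he⟩, ?_⟩⟩, rfl⟩
    refine (Submodule.Quotient.mk_eq_zero N).2 ((hN _).2 ⟨?_, ?_⟩)
    · change d (e • x) = 0
      rw [map_smul, hx, smul_zero]
    · change t (e • x) = 0
      rw [map_smul, hT]

theorem genLaplacian_dotProduct_mulVec {V R : Type*} [Fintype V] [DecidableEq V] [CommRing R]
    (G : SimpleGraph V) [DecidableRel G.Adj] (x w z : V → R) :
    w ⬝ᵥ (genLaplacian G x).mulVec z = (genLaplacian G x).mulVec w ⬝ᵥ z := by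
  have h : (genLaplacian G x).transpose = genLaplacian G x := by
    simp [genLaplacian]
  rw [Matrix.dotProduct_mulVec, ← Matrix.mulVec_transpose, h]

theorem shiftedContinuant_two {R : Type*} [CommRing R] (k : ℕ) :
    shiftedContinuant (fun _ => (2 : R)) k = k := by
  cases k with
  | zero => simp [shiftedContinuant]
  | succ k => simp [shiftedContinuant, pathContinuant_two]

section C5Group

variable {m : ℕ}

/-- Coordinates of the generators of `ℤ^V` in the cokernel along the difference of the first two
leaves. -/
def C5WeightFirst (m : ℕ) : C5Vertex m → ℤ := Sum.elim ![0, -1, 0, m + 1] (fun k => k.val)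

/-- Coordinates of the generators of `ℤ^V` in the cokernel along the difference of the first and
the third leaf. -/
def C5WeightLast (m : ℕ) : C5Vertex m → ℤ := Sum.elim ![0, 0, -1, 1] (fun _ => 0)

theorem C5WeightFirst_spine {k : ℕ} (hk : k ≤ m) : C5WeightFirst m (C5Spine m k) = k := by
  simp only [C5WeightFirst, Sum.elim_inr, C5Spine_val hk]

theorem C5_mulVec_eq_of_forall (hm : 1 ≤ m) (w : C5Vertex m → ℤ) (b : Fin 4 → ℤ)
    (h0 : 2 * w (C5Leaf m 0) - w (C5Spine m 0) = b 0)
    (h1 : 2 * w (C5Leaf m 1) - w (C5Spine m 0) = b 1)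
    (h2 : 2 * w (C5Leaf m 2) - w (C5Spine m m) = b 2)
    (h3 : 2 * w (C5Leaf m 3) - w (C5Spine m m) = b 3)
    (hf : 2 * w (C5Spine m 0) = w (C5Leaf m 0) + w (C5Leaf m 1) + w (C5Spine m 1))
    (hl : 2 * w (C5Spine m m) = w (C5Leaf m 2) + w (C5Leaf m 3) + w (C5Spine m (m - 1)))
    (hs : ∀ k, k + 2 ≤ m → 2 * w (C5Spine m (k + 1)) = w (C5Spine m k) + w (C5Spine m (k + 2))) :
    (genLaplacian (C5 m) (C5d m)).mulVec w = Sum.elim b 0 := by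
  ext (i | k)
  · fin_cases i
    · rw [C5_mulVec_leaf_first _ _ (by simp)]; exact h0
    · rw [C5_mulVec_leaf_first _ _ (by simp)]; exact h1
    · rw [C5_mulVec_leaf_last _ _ (by simp)]; exact h2
    · rw [C5_mulVec_leaf_last _ _ (by simp)]; exact h3
  · rw [C5Spine_surj]
    obtain ⟨k, hk⟩ := k
    change _ = (0 : ℤ)
    change Matrix.mulVec _ _ (C5Spine m k) = 0
    rcases (Nat.le_of_lt_succ hk).eq_or_lt with rfl | hk
    · rw [C5_mulVec_spine_last _ _ (show k = (k - 1) + 1 by omega)]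
      simp only [C5d]
      linarith
    · cases k with
      | zero =>
        rw [C5_mulVec_spine_first _ _ hm]
        simp only [C5d]
        linarith
      | succ k =>
        rw [C5_mulVec_spine _ _ (by omega)]
        simp only [C5d]
        linarith [hs k (by omega)]

theorem C5_mulVec_r (hm : 1 ≤ m) : (genLaplacian (C5 m) (C5d m)).mulVec (C5r m) = 0 := by
  rw [C5_mulVec_eq_of_forall hm _ 0] <;> simp [C5r]

/-- Up to sign, the two weight vectors are the last two columns of `C5Kernel` at `d`, so their
images vanish on the pivot rows. -/
theorem C5_mulVec_weightFirst (hm : 1 ≤ m) :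
    (genLaplacian (C5 m) (C5d m)).mulVec (C5WeightFirst m) =
      Sum.elim ![0, -2, -(m : ℤ), m + 2] 0 := by
  apply C5_mulVec_eq_of_forall hm
  · rw [C5WeightFirst_spine (by omega)]; simp [C5WeightFirst]
  · rw [C5WeightFirst_spine (by omega)]; simp [C5WeightFirst]
  · rw [C5WeightFirst_spine (by omega)]; simp [C5WeightFirst]
  · rw [C5WeightFirst_spine (by omega)]; simp [C5WeightFirst]; ring
  · rw [C5WeightFirst_spine (by omega), C5WeightFirst_spine (by omega)]; simp [C5WeightFirst]
  · rw [C5WeightFirst_spine (by omega), C5WeightFirst_spine (by omega)]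
    simp [C5WeightFirst]; omega
  · intro k hk
    rw [C5WeightFirst_spine (by omega), C5WeightFirst_spine (by omega),
      C5WeightFirst_spine (by omega)]
    push_cast; ring

theorem C5_mulVec_weightLast (hm : 1 ≤ m) :
    (genLaplacian (C5 m) (C5d m)).mulVec (C5WeightLast m) = Sum.elim ![0, 0, -2, 2] 0 := by
  apply C5_mulVec_eq_of_forall hm <;> simp [C5WeightLast]

theorem C5_dotProduct_leaves (w y : C5Vertex m → ℤ) (hy : ∀ k, y (Sum.inr k) = 0) :
    w ⬝ᵥ y = w (C5Leaf m 0) * y (C5Leaf m 0) + w (C5Leaf m 1) * y (C5Leaf m 1) +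
      w (C5Leaf m 2) * y (C5Leaf m 2) + w (C5Leaf m 3) * y (C5Leaf m 3) := by
  simp [dotProduct, hy, Fin.sum_univ_four]

/-- The Laplacian is symmetric, so pairing `w` with an image vector is pairing the image of `w` with
`z`; this yields the necessary conditions. They suffice because, after the pivot rows are cleared, a
3 × 3 system is left to solve. -/
theorem C5_mem_range_iff (hm : 1 ≤ m) (y : C5Vertex m → ℤ) :
    y ∈ LinearMap.range (genLaplacian (C5 m) (C5d m)).mulVecLin ↔ C5r m ⬝ᵥ y = 0 ∧
      ∃ a b : ℤ, C5WeightFirst m ⬝ᵥ y = 2 * a + m * b ∧ C5WeightLast m ⬝ᵥ y = 2 * b := by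
  have himage : ∀ z, C5r m ⬝ᵥ (genLaplacian (C5 m) (C5d m)).mulVec z = 0 ∧
      ∃ a b : ℤ, C5WeightFirst m ⬝ᵥ (genLaplacian (C5 m) (C5d m)).mulVec z = 2 * a + m * b ∧
        C5WeightLast m ⬝ᵥ (genLaplacian (C5 m) (C5d m)).mulVec z = 2 * b := by
    intro z
    simp only [genLaplacian_dotProduct_mulVec, C5_mulVec_r hm, C5_mulVec_weightFirst hm,
      C5_mulVec_weightLast hm]
    refine ⟨by simp, z (C5Leaf m 3) - z (C5Leaf m 1), z (C5Leaf m 3) - z (C5Leaf m 2), ?_, ?_⟩ <;>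
      rw [dotProduct_comm, C5_dotProduct_leaves _ _ (by simp)] <;> simp <;> ring
  constructor
  · rintro ⟨z, rfl⟩
    exact himage z
  · rintro ⟨hr, a, b, hp, hq⟩
    -- Subtracting an image vector that agrees with `y` on the pivot rows leaves `y'`, supported on
    -- `v₂, v₃, v₄`.
    obtain ⟨z, hz⟩ := exists_mulVec_eq_on_pivots (genLaplacian (C5 m) (C5d m))
      (Equiv.ofBijective _ C5Row_bijective) (Equiv.ofBijective _ C5Col_bijective)
      (C5_det_pivot_isUnit _) y
    obtain ⟨hr', a', b', hp', hq'⟩ := himage z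
    set y' := y - (genLaplacian (C5 m) (C5d m)).mulVec z with hy'
    have hpivot : ∀ k, y' (C5Row m (Sum.inl k)) = 0 := by
      intro k
      have := hz k
      rw [Equiv.ofBijective_apply] at this
      rw [hy', Pi.sub_apply, this, sub_self]
    have hspine : ∀ k, y' (Sum.inr k) = 0 := by
      intro k
      have := hpivot k.succ
      simpa [C5Row, C5Spine_surj] using this
    have hleaf : y' (C5Leaf m 0) = 0 := by simpa [C5Row] using hpivot 0
    have er : C5r m ⬝ᵥ y' = 0 := by rw [hy', dotProduct_sub, hr, hr', sub_self]
    have ep : C5WeightFirst m ⬝ᵥ y' = 2 * (a - a') + m * (b - b') := by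
      rw [hy', dotProduct_sub, hp, hp']; ring
    have eq : C5WeightLast m ⬝ᵥ y' = 2 * (b - b') := by
      rw [hy', dotProduct_sub, hq, hq']; ring
    rw [C5_dotProduct_leaves _ _ hspine, hleaf] at er ep eq
    simp [C5r, C5WeightFirst, C5WeightLast] at er ep eq
    have e3 : y' (C5Leaf m 3) = y' (C5Leaf m 2) + 2 * (b - b') := by linarith
    have e1 : y' (C5Leaf m 1) = -(2 * y' (C5Leaf m 2)) - 2 * (b - b') := by linarith
    rw [e1, e3] at ep
    -- At `d` the vector (1, 1, 1), which corresponds to `r`, is in the kernel of the reduced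
    -- matrix, so the first coordinate may be 0. The first two rows then determine the others.
    let c : Fin 3 → ℤ :=
      ![0, -y' (C5Leaf m 2) - (b - b'), (a - a') - y' (C5Leaf m 2) - 2 * (b - b')]
    refine ⟨z + (C5Kernel (C5d m)).mulVec c, ?_⟩
    rw [Matrix.mulVecLin_apply, Matrix.mulVec_add, ← eq_sub_iff_add_eq', ← hy',
      Matrix.mulVec_mulVec]
    ext v
    obtain ⟨(k | i), rfl⟩ := C5Row_bijective.surjective v
    · rw [hpivot]
      simp [Matrix.mulVec, dotProduct, C5Kernel_mul_pivot (C5d m) hm]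
    · change _ = y' (C5Leaf m i.succ)
      change ∑ j, (genLaplacian (C5 m) (C5d m) * C5Kernel (C5d m)) (C5Leaf m i.succ) j * c j = _
      simp only [C5Kernel_mul_leaf, Fin.sum_univ_three]
      fin_cases i <;>
        simp [C5ReducedOf, C5Reduced, c, C5d, pathContinuant_two, shiftedContinuant_two] <;>
        linarith

theorem C5_criticalGroup (hm : 1 ≤ m) {T : Type*} [AddCommGroup T] (τ : ℤ × ℤ →ₗ[ℤ] T)
    (hτ : ∀ p q : ℤ, τ (p, q) = 0 ↔ ∃ a b : ℤ, p = 2 * a + m * b ∧ q = 2 * b)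
    (hs : Function.Surjective τ) (hT : ∀ y : T, (4 : ℤ) • y = 0) :
    Nonempty (criticalGroup (C5 m) (C5d m) ≃+ T) := by
  let d : (C5Vertex m → ℤ) →ₗ[ℤ] ℤ := dotProductBilin ℤ ℤ (C5r m)
  let p : (C5Vertex m → ℤ) →ₗ[ℤ] ℤ := dotProductBilin ℤ ℤ (C5WeightFirst m)
  let q : (C5Vertex m → ℤ) →ₗ[ℤ] ℤ := dotProductBilin ℤ ℤ (C5WeightLast m)
  refine nonempty_torsion_quotient_addEquiv _ d (τ.comp (p.prod q)) (fun y => ?_) (fun y => ?_)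
    (show (4 : ℤ) ≠ 0 by norm_num) hT
  · rw [C5_mem_range_iff hm, LinearMap.comp_apply]
    exact and_congr Iff.rfl (hτ _ _).symm
  · obtain ⟨⟨a, b⟩, rfl⟩ := hs y
    -- A vector orthogonal to `r` whose pairings with the two weights are exactly a and b.
    let v : C5Vertex m → ℤ := Sum.elim ![a + b, -a, -b, 0] 0
    have hv : ∀ w, w ⬝ᵥ v = w (C5Leaf m 0) * (a + b) + w (C5Leaf m 1) * (-a) +
        w (C5Leaf m 2) * (-b) := by
      intro w
      rw [C5_dotProduct_leaves _ _ (by simp [v])]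
      simp [v]
    refine ⟨v, ?_, ?_⟩
    · change C5r m ⬝ᵥ v = 0
      rw [hv]
      simp [C5r]
    · change τ (C5WeightFirst m ⬝ᵥ v, C5WeightLast m ⬝ᵥ v) = τ (a, b)
      rw [hv, hv]
      simp [C5WeightFirst, C5WeightLast]

theorem C5_criticalGroup_even (hm : 1 ≤ m) (h : Even m) :
    Nonempty (criticalGroup (C5 m) (C5d m) ≃+ ZMod 2 × ZMod 2) := by
  let c := (Int.castAddHom (ZMod 2)).toIntLinearMap
  refine C5_criticalGroup hm (c.prodMap c) (fun p q => ?_) ?_ (by decide)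
  · change ((p : ZMod 2), (q : ZMod 2)) = 0 ↔ _
    rw [Prod.mk_eq_zero, ZMod.intCast_zmod_eq_zero_iff_dvd, ZMod.intCast_zmod_eq_zero_iff_dvd]
    obtain ⟨n, rfl⟩ := h
    push_cast
    constructor
    · rintro ⟨⟨a, rfl⟩, ⟨b, rfl⟩⟩
      exact ⟨a - n * b, b, by ring, rfl⟩
    · rintro ⟨a, b, rfl, rfl⟩
      exact ⟨⟨a + n * b, by ring⟩, ⟨b, rfl⟩⟩
  · exact Function.Surjective.prodMap ZMod.intCast_surjective ZMod.intCast_surjective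

theorem C5_criticalGroup_odd (hm : 1 ≤ m) (h : Odd m) :
    Nonempty (criticalGroup (C5 m) (C5d m) ≃+ ZMod 4) := by
  let c := (Int.castAddHom (ZMod 4)).toIntLinearMap
  -- For odd m the lattice spanned by (2, 0) and (m, 2) is the kernel of (p, q) ↦ 2p + q modulo 4.
  refine C5_criticalGroup hm (c.comp ((2 : ℤ) • LinearMap.fst ℤ ℤ ℤ + LinearMap.snd ℤ ℤ ℤ))
    (fun p q => ?_) (fun y => ?_) (by decide)
  · change (((2 : ℤ) * p + q : ℤ) : ZMod 4) = 0 ↔ _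
    rw [ZMod.intCast_zmod_eq_zero_iff_dvd]
    obtain ⟨n, rfl⟩ := h
    push_cast
    constructor
    · rintro ⟨k, hk⟩
      exact ⟨p - k - n * (2 * k - p), 2 * k - p, by ring, by linarith⟩
    · rintro ⟨a, b, rfl, rfl⟩
      exact ⟨a + n * b + b, by ring⟩
  · obtain ⟨z, rfl⟩ := ZMod.intCast_surjective y
    exact ⟨(0, z), by simp [c]⟩

theorem C5_isArithmeticalGraph (hm : 1 ≤ m) : IsArithmeticalGraph (C5 m) (C5d m) (C5r m) where
  d_pos _ := by norm_num [C5d]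
  r_pos v := by cases v <;> norm_num [C5r]
  mulVec_eq_zero := C5_mulVec_r hm

end C5Group

/-! ### The critical ideals -/

section C5CriticalIdeals

variable {m : ℕ}

theorem C5_criticalIdeal (hm : 1 ≤ m) (j : ℕ) : criticalIdeal (C5 m) (m + 2 + j) =
    minorIdeal (C5ReducedOf (MvPolynomial.X : C5Vertex m → MvPolynomial (C5Vertex m) ℤ)) j := by
  rw [criticalIdeal_eq_minorIdeal]
  exact minorIdeal_C5 _ hm j

theorem C5_criticalIdeal_corank_succ (hm : 1 ≤ m) : criticalIdeal (C5 m) (m + 3) =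
    Ideal.span {MvPolynomial.X (C5Leaf m 0), MvPolynomial.X (C5Leaf m 1),
      MvPolynomial.X (C5Leaf m 2), MvPolynomial.X (C5Leaf m 3),
      shiftedContinuant (C5Var m) m} := by
  rw [C5_criticalIdeal hm 1]
  exact minorIdeal_C5Reduced_one _ _ _ _ _ _ _ _

theorem C5_criticalIdeal_corank_succ_ne_top (hm : 2 ≤ m) : criticalIdeal (C5 m) (m + 3) ≠ ⊤ := by
  intro h
  -- With all path variables equal to 2, the continuant of the m - 1 inner path vertices is m, which
  -- is 0 in `ZMod m`. This ring is nontrivial, so the kernel of `φ` is a proper ideal.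
  have : Fact (1 < m) := ⟨hm⟩
  let φ : MvPolynomial (C5Vertex m) ℤ →+* ZMod m :=
    MvPolynomial.eval₂Hom (Int.castRingHom _) (Sum.elim (fun _ => 0) (fun _ => 2))
  have hle : criticalIdeal (C5 m) (m + 3) ≤ RingHom.ker φ := by
    rw [C5_criticalIdeal_corank_succ (by omega), Ideal.span_le]
    have hR : φ (shiftedContinuant (C5Var m) m) = 0 := by
      have h2 : (fun k => φ (C5Var m k)) = fun _ => 2 := by
        ext k
        simp [φ, C5Var]
      obtain ⟨n, rfl⟩ : ∃ n, m = n + 1 := ⟨m - 1, by omega⟩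
      rw [shiftedContinuant, map_pathContinuant, h2, pathContinuant_two]
      exact_mod_cast ZMod.natCast_self (n + 1)
    rintro p (rfl | rfl | rfl | rfl | rfl)
    · simp [φ]
    · simp [φ]
    · simp [φ]
    · simp [φ]
    · exact hR
  rw [h, top_le_iff] at hle
  exact RingHom.ker_ne_top φ hle

theorem C5_criticalIdeal_eq_top_iff (hm : 2 ≤ m) (j : ℕ) :
    criticalIdeal (C5 m) j = ⊤ ↔ j ≤ m + 2 := by
  have hanti : Antitone (criticalIdeal (C5 m)) := fun a b hab => by
    rw [criticalIdeal_eq_minorIdeal, criticalIdeal_eq_minorIdeal]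
    exact minorIdeal_antitone _ hab
  constructor
  · intro h
    by_contra! hj
    exact C5_criticalIdeal_corank_succ_ne_top hm (top_le_iff.1 (h ▸ hanti hj))
  · intro hj
    refine top_le_iff.1 (le_trans (le_of_eq ?_) (hanti hj))
    exact ((C5_criticalIdeal (by omega) 0).trans (minorIdeal_zero _)).symm

theorem C5_criticalIdeal_corank_add_two {n : ℕ} (hm : m = n + 2) :
    criticalIdeal (C5 m) (m + 4) =
      Ideal.span {MvPolynomial.X (C5Leaf m 0) * MvPolynomial.X (C5Leaf m 2),
        MvPolynomial.X (C5Leaf m 0) * MvPolynomial.X (C5Leaf m 3),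
        MvPolynomial.X (C5Leaf m 1) * MvPolynomial.X (C5Leaf m 2),
        MvPolynomial.X (C5Leaf m 1) * MvPolynomial.X (C5Leaf m 3),
        (MvPolynomial.X (C5Leaf m 0) * MvPolynomial.X (C5Leaf m 1) * C5Var m 0
          - MvPolynomial.X (C5Leaf m 0) - MvPolynomial.X (C5Leaf m 1)) *
            pathContinuant (C5Var m) 1 (n + 1) -
          MvPolynomial.X (C5Leaf m 0) * MvPolynomial.X (C5Leaf m 1) *
            pathContinuant (C5Var m) 2 n,
        (MvPolynomial.X (C5Leaf m 2) * MvPolynomial.X (C5Leaf m 3) * C5Var m m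
          - MvPolynomial.X (C5Leaf m 2) - MvPolynomial.X (C5Leaf m 3)) *
            pathContinuant (C5Var m) 1 (n + 1) -
          MvPolynomial.X (C5Leaf m 2) * MvPolynomial.X (C5Leaf m 3) *
            pathContinuant (C5Var m) 1 n} := by
  rw [C5_criticalIdeal (by omega) 2]
  refine (minorIdeal_C5Reduced_two _ _ _ _ _ _ _ _).trans ?_
  change Ideal.span {_, _, _, _, _ * pathContinuant (C5Var m) 0 m
      - _ * shiftedContinuant (C5Var m) m,
    _ * shiftedContinuant (C5Var m) (m + 1) - _ * shiftedContinuant (C5Var m) m} = _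
  -- Expanding at `v₅` and at `v₆` exposes the common factor, the continuant of the inner path, and
  -- yields the factors of the stated generators.
  have hA : ∀ k, k = n + 2 → pathContinuant (C5Var m) 0 k =
      C5Var m 0 * pathContinuant (C5Var m) 1 (n + 1) - pathContinuant (C5Var m) 2 n := by
    rintro k rfl
    exact pathContinuant_succ_succ _ 0 n
  have hB : ∀ k, k = n + 2 →
      shiftedContinuant (C5Var m) k = pathContinuant (C5Var m) 1 (n + 1) := by
    rintro k rfl
    rfl
  have hB' : ∀ k, k = n + 2 → shiftedContinuant (C5Var m) (k + 1) =
      C5Var m k * pathContinuant (C5Var m) 1 (n + 1) - pathContinuant (C5Var m) 1 n := by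
    rintro k rfl
    rw [shiftedContinuant, pathContinuant_succ_succ', show 1 + n + 1 = n + 2 by omega]
  rw [hA m hm, hB m hm, hB' m hm]
  congr 6
  · ring
  · congr 1
    ring

end C5CriticalIdeals

theorem mainTheorem10 (m : ℕ) (hm : 5 ≤ m) :
    -- it is a tree, and an arithmetical graph with these vectors
    (C5 m).IsTree ∧ IsArithmeticalGraph (C5 m) (C5d m) (C5r m) ∧
    -- the algebraic corank, the three non-trivial critical ideals, and the last of them
    IsAlgebraicCorank (C5 m) (m + 2) ∧
    (∀ j : ℕ, 1 ≤ j → j ≤ m + 5 → (criticalIdeal (C5 m) j ≠ ⊤ ↔ m + 3 ≤ j)) ∧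
    criticalIdeal (C5 m) (m + 5) = Ideal.span {(genLaplacianX (C5 m)).det} ∧
    -- the other two non-trivial critical ideals
    (let v₁ := C5Leaf m 0
     let v₂ := C5Leaf m 1
     let v₃ := C5Leaf m 2
     let v₄ := C5Leaf m 3
     let v₇ := C5Spine m 1
     let v₈ := C5Spine m (m - 1)
     let v₉ := C5Spine m 2
     let v₁₀ := C5Spine m (m - 2)
     let x : C5Vertex m → MvPolynomial (C5Vertex m) ℤ := MvPolynomial.X
     let P := pathDet (C5 m)
     criticalIdeal (C5 m) (m + 3) = Ideal.span {x v₁, x v₂, x v₃, x v₄, P v₇ v₈} ∧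
     criticalIdeal (C5 m) (m + 4) =
       Ideal.span {x v₁ * x v₃, x v₁ * x v₄, x v₂ * x v₃, x v₂ * x v₄,
         P v₁ v₂ * P v₇ v₈ - x v₁ * x v₂ * P v₉ v₈,
         P v₃ v₄ * P v₇ v₈ - x v₃ * x v₄ * P v₇ v₁₀}) ∧
    -- the group of components
    (Even m → Nonempty (criticalGroup (C5 m) (C5d m) ≃+ ZMod 2 × ZMod 2)) ∧
    (Odd m → Nonempty (criticalGroup (C5 m) (C5d m) ≃+ ZMod 4)) := by
  -- With m = n + 3 the subtractions m - 1 and m - 2 are exact, and the paths `v₇v₈`, `v₉v₈`,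
  -- `v₇v₁₀` have n + 2, n + 1 and n + 1 vertices.
  obtain ⟨n, rfl⟩ : ∃ n, m = n + 3 := ⟨m - 3, by omega⟩
  have hpath : ∀ i n' : ℕ, i + n' ≤ n + 3 → ∀ j, j = i + n' →
      pathDet (C5 (n + 3)) (C5Spine (n + 3) i) (C5Spine (n + 3) j) =
        pathContinuant (C5Var (n + 3)) i (n' + 1) := by
    rintro i n' h j rfl
    exact C5_pathDet_spine h
  have h78 := hpath 1 (n + 1) (by omega) (n + 3 - 1) (by omega)
  have h98 := hpath 2 n (by omega) (n + 3 - 1) (by omega)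
  have h710 := hpath 1 n (by omega) (n + 3 - 2) (by omega)
  have h12 := C5_pathDet_leaves (m := n + 3) (a := 0) (b := 1) (by decide) (k := 0)
    ((C5_adj_leaf_spine _ _).2 (Or.inl ⟨by decide, C5Spine_val (by omega)⟩))
    ((C5_adj_leaf_spine _ _).2 (Or.inl ⟨by decide, C5Spine_val (by omega)⟩))
  have h34 := C5_pathDet_leaves (m := n + 3) (a := 2) (b := 3) (by decide) (k := n + 3)
    ((C5_adj_leaf_spine _ _).2 (Or.inr ⟨by decide, C5Spine_val (by omega)⟩))
    ((C5_adj_leaf_spine _ _).2 (Or.inr ⟨by decide, C5Spine_val (by omega)⟩))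
  refine ⟨C5_isTree, C5_isArithmeticalGraph (by omega),
    ⟨(C5_criticalIdeal_eq_top_iff (by omega) _).2 le_rfl,
      fun j hj => (C5_criticalIdeal_eq_top_iff (by omega) j).1 hj⟩, fun j _ _ => ?_, ?_, ⟨?_, ?_⟩,
    C5_criticalGroup_even (by omega), C5_criticalGroup_odd (by omega)⟩
  · rw [ne_eq, C5_criticalIdeal_eq_top_iff (by omega)]
    omega
  · rw [criticalIdeal_eq_minorIdeal]
    exact minorIdeal_card _ (by simp; omega)
  · rw [C5_criticalIdeal_corank_succ (by omega), h78]
    rfl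
  · rw [C5_criticalIdeal_corank_add_two (n := n + 1) rfl, h78, h98, h710, h12, h34]
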